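/- Let $n\ge 1$ and $c\in\{-1,0,1\}$, and let $\mathbb Q^{n+1}_c$ be the $(n+1)$-dimensional space form of curvature $c$: Euclidean space $\mathbb R^{n+1}$ if $c=0$, the unit sphere $\mathbb S^{n+1}\subset\mathbb R^{n+2}$ if $c=1$, the hyperboloid model $\mathbb H^{n+1}$ of hyperbolic space in Minkowski space if $c=-1$, with its standard Riemannian metric $\langle\cdot,\cdot\rangle$. Let $I\subset\mathbb R$ be an open interval, $w:I\to(0,\infty)$ a smooth function, and let $\mathbb Q^{n+1}_c\times_w I$ be the product $\mathbb Q^{n+1}_c\times I$ with the Lorentzian metric $\langle\cdot,\cdot\rangle_w=w(t)^2\langle\cdot,\cdot\rangle-dt^2$. The mean curvature vector $\vec H$ of an immersed $n$-dimensional submanifold is $\frac1n$ times the trace, with respect to the induced metric, of its second fundamental form. The submanifold is called marginally trapped if $\vec H$ is everywhere null, i.e. $\langle\vec H,\vec H\rangle_w$ vanishes identically (points where $\vec H=0$ are allowed). Let $\varphi:M\to\mathbb Q^{n+1}_c$ be an immersed hypersurface of class $C^2$ ($M$ an $n$-dimensional manifold without boundary) and let $T\in I$. Then the codimension-two submanifold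 $x\mapsto(\varphi(x),T)$ of $\mathbb Q^{n+1}_c\times_w I$, contained in the time slice $\{t=T\}$, is marginally trapped if and only if the hypersurface $\varphi$ has constant mean curvature $w'(T)$, i.e. every point of $M$ has an open neighbourhood carrying a continuous unit normal field $\nu$ along $\varphi$ for which the scalar mean curvature $\langle\vec H_\varphi,\nu\rangle$ is identically $w'(T)$, where $\vec H_\varphi$ is the mean curvature vector of $\varphi$ in $\mathbb Q^{n+1}_c$. Moreover, if $\varphi$ admits a global continuous unit normal field, then the submanifold is marginally trapped if and only if there is a global continuous unit normal field $\nu$ along $\varphi$ with $\langle\vec H_\varphi,\nu\rangle\equiv w'(T)$. -/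

import Mathlib

open scoped Manifold ContDiff Topology

noncomputable section

namespace RobertsonWalker

/-! ### Submanifold geometry in a (pseudo-)Riemannian manifold -/

/-- A field of bilinear forms on the tangent spaces of `N`: a `(0,2)`-tensor field, such as a
pseudo-Riemannian metric. -/
abbrev TensorField {E : Type*} [NormedAddCommGroup E] [NormedSpace ℝ E]
    {H : Type*} [TopologicalSpace H] (I : ModelWithCorners ℝ E H)
    (N : Type*) [TopologicalSpace N] [ChartedSpace H N] : Type _ :=
  (p : N) → LinearMap.BilinForm ℝ (TangentSpace I p)

section LeviCivita

variable {E : Type*} [NormedAddCommGroup E] [NormedSpace ℝ E]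
  {H : Type*} [TopologicalSpace H] {I : ModelWithCorners ℝ E H}
  {N : Type*} [TopologicalSpace N] [ChartedSpace H N]

/-- The component `g (u, v)` of the metric, as a function of the point `y` of the coordinate space
`E`, in the preferred chart at `p`; here `u` and `v` are constant vectors of the coordinate
space. -/
def metricInChart (g : TensorField I N) (p : N) (u v : E) (y : E) : ℝ :=
  g ((extChartAt I p).symm y)
    (mfderiv 𝓘(ℝ, E) I (extChartAt I p).symm y u)
    (mfderiv 𝓘(ℝ, E) I (extChartAt I p).symm y v)

/-- Christoffel symbols of the first kind at `p`, in the preferred chart at `p`: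
`Γ(u, v; z) = (1/2) (∂_u g(v, z) + ∂_v g(u, z) - ∂_z g(u, v))`. -/
def christoffelFirst (g : TensorField I N) (p : N) (u v z : E) : ℝ :=
  (1 / 2) * (fderiv ℝ (metricInChart g p v z) (extChartAt I p p) u
    + fderiv ℝ (metricInChart g p u z) (extChartAt I p p) v
    - fderiv ℝ (metricInChart g p u v) (extChartAt I p p) z)

open Classical in
/-- Christoffel symbols of the second kind at `p`, in the preferred chart at `p`: the vector
`Γ(u, v)` such that `g (Γ(u, v), z) = Γ(u, v; z)` for all `z`. It exists and is unique when the
metric is nondegenerate (and `N` is finite-dimensional). The space `TangentSpace I p` is, by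
definition, the coordinate space of the preferred chart at `p`. -/
def christoffel (g : TensorField I N) (p : N) (u v : TangentSpace I p) : TangentSpace I p :=
  if h : ∃ a : TangentSpace I p, ∀ z : TangentSpace I p, g p a z = christoffelFirst g p u v z
  then h.choose else 0

variable {n : ℕ} {M : Type*} [TopologicalSpace M] [ChartedSpace (EuclideanSpace ℝ (Fin n)) M]

/-- The map `f : M → N` is an immersion of class `C^k`. -/
def IsImmersionOfClass (I : ModelWithCorners ℝ E H) (n : ℕ)
    {M : Type*} [TopologicalSpace M] [ChartedSpace (EuclideanSpace ℝ (Fin n)) M]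
    (k : ℕ∞ω) (f : M → N) : Prop :=
  ContMDiff (𝓡 n) I k f ∧ ∀ x : M, Function.Injective (mfderiv (𝓡 n) I f x)

/-- The covariant second derivative `D_u (df v)` at `x` of `f : M → N`, where `v` is extended
with constant coefficients in the preferred chart at `x` and `D` is the Levi-Civita connection of
`g`: in coordinates it is `∂_u ∂_v f + Γ(df u, df v)`. -/
def covariantHessian (g : TensorField I N) (f : M → N) (x : M) (u v : TangentSpace (𝓡 n) x) :
    TangentSpace I (f x) :=
  let d₂ : TangentSpace I (f x) :=
    fderiv ℝ (fderiv ℝ (writtenInExtChartAt (𝓡 n) I x f)) (extChartAt (𝓡 n) x x) u v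
  d₂ + christoffel g (f x) (mfderiv (𝓡 n) I f x u) (mfderiv (𝓡 n) I f x v)

/-- The tangent vector `ξ` of `N` at `f x` is normal to `f`. -/
def IsNormal (g : TensorField I N) (f : M → N) (x : M) (ξ : TangentSpace I (f x)) : Prop :=
  ∀ u : TangentSpace (𝓡 n) x, g (f x) ξ (mfderiv (𝓡 n) I f x u) = 0

open Classical in
/-- The component of `ξ` normal to `f`. It exists and is unique whenever the metric induced by `f`
is nondegenerate. -/
def normalPart (g : TensorField I N) (f : M → N) (x : M) (ξ : TangentSpace I (f x)) :
    TangentSpace I (f x) :=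
  if h : ∃ η : TangentSpace I (f x), IsNormal (n := n) g f x η ∧
      ∃ u : TangentSpace (𝓡 n) x, ξ = mfderiv (𝓡 n) I f x u + η
  then h.choose else 0

/-- The (vector-valued) second fundamental form of `f`: the normal part of `D_u (df v)`. -/
def secondFundamentalForm (g : TensorField I N) (f : M → N) (x : M)
    (u v : TangentSpace (𝓡 n) x) : TangentSpace I (f x) :=
  normalPart (n := n) g f x (covariantHessian g f x u v)

/-- The `i`-th vector of the coordinate basis of `T_x M`, in the preferred chart at `x`. -/
def coordVec (x : M) (i : Fin n) : TangentSpace (𝓡 n) x :=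
  (show EuclideanSpace ℝ (Fin n) from EuclideanSpace.single i 1)

/-- The Gram matrix, in the coordinate basis of `T_x M`, of the metric induced by `f`. -/
def gramMatrix (g : TensorField I N) (f : M → N) (x : M) : Matrix (Fin n) (Fin n) ℝ :=
  Matrix.of fun i j =>
    g (f x) (mfderiv (𝓡 n) I f x (coordVec x i)) (mfderiv (𝓡 n) I f x (coordVec x j))

/-- The mean curvature vector of `f`: `1 / n` times the trace, with respect to the metric induced
by `f`, of the second fundamental form. -/
def meanCurvatureVector (g : TensorField I N) (f : M → N) (x : M) : TangentSpace I (f x) :=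
  (1 / (n : ℝ)) • ∑ i : Fin n, ∑ j : Fin n,
    ((gramMatrix g f x)⁻¹ i j) • secondFundamentalForm g f x (coordVec x i) (coordVec x j)

/-- The submanifold given by the immersion `f` is marginally trapped: its mean curvature vector is
everywhere null (possibly zero). -/
def IsMarginallyTrapped (g : TensorField I N) (n : ℕ)
    {M : Type*} [TopologicalSpace M] [ChartedSpace (EuclideanSpace ℝ (Fin n)) M]
    (f : M → N) : Prop :=
  ∀ x : M, g (f x) (meanCurvatureVector (n := n) g f x) (meanCurvatureVector (n := n) g f x) = 0

/-- `ν` is a continuous unit normal field along `f` on the subset `U` of `M`. (For a hypersurface,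
a continuous unit normal field is automatically as regular as `df`.) -/
def IsUnitNormalFieldOn [IsManifold I 1 N] (g : TensorField I N) (n : ℕ)
    {M : Type*} [TopologicalSpace M] [ChartedSpace (EuclideanSpace ℝ (Fin n)) M]
    (f : M → N) (U : Set M) (ν : (x : M) → TangentSpace I (f x)) : Prop :=
  ContinuousOn (fun x => (⟨f x, ν x⟩ : TangentBundle I N)) U ∧
    ∀ x ∈ U, IsNormal (n := n) g f x (ν x) ∧ g (f x) (ν x) (ν x) = 1

/-- The scalar mean curvature `⟨H, ν⟩` of a hypersurface `f` with respect to a unit normal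
field `ν`. -/
def meanCurvature (g : TensorField I N) (n : ℕ)
    {M : Type*} [TopologicalSpace M] [ChartedSpace (EuclideanSpace ℝ (Fin n)) M]
    (f : M → N) (ν : (x : M) → TangentSpace I (f x)) (x : M) : ℝ :=
  g (f x) (meanCurvatureVector (n := n) g f x) (ν x)

/-- The hypersurface `f` has constant mean curvature `k`: near every point there is a unit normal
field with respect to which the scalar mean curvature is identically `k`. -/
def HasConstantMeanCurvature [IsManifold I 1 N] (g : TensorField I N) (n : ℕ)
    {M : Type*} [TopologicalSpace M] [ChartedSpace (EuclideanSpace ℝ (Fin n)) M]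
    (f : M → N) (k : ℝ) : Prop :=
  ∀ x : M, ∃ U : Set M, IsOpen U ∧ x ∈ U ∧
    ∃ ν : (x : M) → TangentSpace I (f x), IsUnitNormalFieldOn g n f U ν ∧
      ∀ y ∈ U, meanCurvature g n f ν y = k

/-- The hypersurface `f` has constant mean curvature `k` with respect to a globally defined unit
normal field. -/
def HasConstantMeanCurvatureGlobally [IsManifold I 1 N] (g : TensorField I N) (n : ℕ)
    {M : Type*} [TopologicalSpace M] [ChartedSpace (EuclideanSpace ℝ (Fin n)) M]
    (f : M → N) (k : ℝ) : Prop :=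
  ∃ ν : (x : M) → TangentSpace I (f x), IsUnitNormalFieldOn g n f Set.univ ν ∧
    ∀ x : M, meanCurvature g n f ν x = k

end LeviCivita

/-! ### Hyperbolic space -/

/-- The Lorentzian form `dx_1² + ⋯ + dx_m² - dx_{m+1}²` on `ℝ^{m+1}`. -/
def lorentzForm (m : ℕ) : LinearMap.BilinForm ℝ (EuclideanSpace ℝ (Fin (m + 1))) :=
  LinearMap.mk₂ ℝ
    (fun x y => (∑ i : Fin m, x i.castSucc * y i.castSucc) - x (Fin.last m) * y (Fin.last m))
    (by intro x x' y; simp only [PiLp.add_apply, add_mul, Finset.sum_add_distrib]; ring)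
    (by
      intro a x y
      simp only [PiLp.smul_apply, smul_eq_mul, mul_sub, Finset.mul_sum, mul_assoc])
    (by intro x y y'; simp only [PiLp.add_apply, mul_add, Finset.sum_add_distrib]; ring)
    (by
      intro a x y
      simp only [PiLp.smul_apply, smul_eq_mul, mul_sub, Finset.mul_sum, mul_left_comm])

/-- Hyperbolic space `ℍ^m`: the upper sheet of the hyperboloid in Minkowski space. -/
def Hyperbolic (m : ℕ) : Type :=
  {x : EuclideanSpace ℝ (Fin (m + 1)) // lorentzForm m x x = -1 ∧ 0 < x (Fin.last m)}

namespace Hyperbolic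

variable {m : ℕ}

/-- The inclusion of hyperbolic space in Minkowski space. -/
def incl (x : Hyperbolic m) : EuclideanSpace ℝ (Fin (m + 1)) := x.1

instance : TopologicalSpace (Hyperbolic m) :=
  inferInstanceAs (TopologicalSpace
    {x : EuclideanSpace ℝ (Fin (m + 1)) // lorentzForm m x x = -1 ∧ 0 < x (Fin.last m)})

/-- The point of the hyperboloid above `y ∈ ℝ^m`. -/
def lift (y : EuclideanSpace ℝ (Fin m)) : EuclideanSpace ℝ (Fin (m + 1)) :=
  WithLp.toLp 2 (Fin.snoc (α := fun _ => ℝ) (fun i => y i) (Real.sqrt (1 + ∑ i, y i ^ 2)))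

theorem lift_castSucc (y : EuclideanSpace ℝ (Fin m)) (i : Fin m) : lift y i.castSucc = y i := by
  simp [lift]

theorem lift_last (y : EuclideanSpace ℝ (Fin m)) :
    lift y (Fin.last m) = Real.sqrt (1 + ∑ i, y i ^ 2) := by
  simp [lift]

theorem one_add_pos (y : EuclideanSpace ℝ (Fin m)) : 0 < 1 + ∑ i, y i ^ 2 := by
  have : 0 ≤ ∑ i, y i ^ 2 := Finset.sum_nonneg fun i _ => sq_nonneg _
  linarith

/-- The vertical projection identifies the hyperboloid with `ℝ^m`. -/
def projHomeo (m : ℕ) : Hyperbolic m ≃ₜ EuclideanSpace ℝ (Fin m) where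
  toFun x := WithLp.toLp 2 fun i => x.1 i.castSucc
  invFun y := ⟨lift y, by
    constructor
    · simp only [lorentzForm, LinearMap.mk₂_apply, lift_castSucc, lift_last]
      rw [Real.mul_self_sqrt (one_add_pos y).le]
      simp only [sq]
      ring
    · rw [lift_last]
      exact Real.sqrt_pos.mpr (one_add_pos y)⟩
  left_inv x := by
    obtain ⟨x, hx, hpos⟩ := x
    apply Subtype.ext
    ext j
    simp only [lorentzForm, LinearMap.mk₂_apply] at hx
    have h : Real.sqrt (1 + ∑ i : Fin m, x i.castSucc ^ 2) = x (Fin.last m) := by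
      rw [Real.sqrt_eq_iff_mul_self_eq_of_pos hpos]
      simp only [sq]
      linarith
    refine Fin.lastCases ?_ (fun i => ?_) j
    · exact (lift_last _).trans h
    · exact lift_castSucc _ i
  right_inv y := by
    ext i
    exact lift_castSucc y i
  continuous_toFun := by
    have h : Continuous fun x : Hyperbolic m => x.1 := continuous_subtype_val
    fun_prop
  continuous_invFun := by
    refine Continuous.subtype_mk ?_ _
    refine (PiLp.continuous_toLp 2 _).comp ?_
    refine continuous_pi fun j => ?_
    refine Fin.lastCases ?_ (fun i => ?_) j
    · simp only [Fin.snoc_last]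
      fun_prop
    · simp only [Fin.snoc_castSucc]
      fun_prop

instance : ChartedSpace (EuclideanSpace ℝ (Fin m)) (Hyperbolic m) :=
  (projHomeo m).toOpenPartialHomeomorph.singletonChartedSpace rfl

instance (k : ℕ∞ω) : IsManifold (𝓡 m) k (Hyperbolic m) :=
  (projHomeo m).toOpenPartialHomeomorph.isManifold_singleton rfl

/-- The metric of hyperbolic space, induced by the Lorentzian form of the ambient space. -/
def metric (m : ℕ) : TensorField (𝓡 m) (Hyperbolic m) := fun x =>
  (lorentzForm m).compl₁₂
    (mfderiv (𝓡 m) 𝓘(ℝ, EuclideanSpace ℝ (Fin (m + 1))) incl x).toLinearMap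
    (mfderiv (𝓡 m) 𝓘(ℝ, EuclideanSpace ℝ (Fin (m + 1))) incl x).toLinearMap

end Hyperbolic

/-! ### The space forms -/

theorem isManifold_sphere (m : ℕ) (k : ℕ∞ω) :
    IsManifold (𝓡 m) k (Metric.sphere (0 : EuclideanSpace ℝ (Fin (m + 1))) 1) :=
  .of_le (n := ω) le_top

/-- The space form `ℚ^m_c` of dimension `m` and curvature `c ∈ {-1, 0, 1}`: Euclidean space, the unit
sphere of `ℝ^{m+1}`, or hyperbolic space. -/
def SpaceForm (m : ℕ) : SignType → Type
  | .zero => EuclideanSpace ℝ (Fin m)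
  | .neg => Hyperbolic m
  | .pos => Metric.sphere (0 : EuclideanSpace ℝ (Fin (m + 1))) 1

namespace SpaceForm

variable {m : ℕ}

instance : (c : SignType) → TopologicalSpace (SpaceForm m c)
  | .zero => inferInstanceAs (TopologicalSpace (EuclideanSpace ℝ (Fin m)))
  | .neg => inferInstanceAs (TopologicalSpace (Hyperbolic m))
  | .pos => inferInstanceAs
      (TopologicalSpace (Metric.sphere (0 : EuclideanSpace ℝ (Fin (m + 1))) 1))

instance : (c : SignType) → ChartedSpace (EuclideanSpace ℝ (Fin m)) (SpaceForm m c)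
  | .zero => inferInstanceAs (ChartedSpace (EuclideanSpace ℝ (Fin m)) (EuclideanSpace ℝ (Fin m)))
  | .neg => inferInstanceAs (ChartedSpace (EuclideanSpace ℝ (Fin m)) (Hyperbolic m))
  | .pos => inferInstanceAs (ChartedSpace (EuclideanSpace ℝ (Fin m))
      (Metric.sphere (0 : EuclideanSpace ℝ (Fin (m + 1))) 1))

instance (k : ℕ∞ω) : (c : SignType) → IsManifold (𝓡 m) k (SpaceForm m c)
  | .zero => inferInstanceAs (IsManifold (𝓡 m) k (EuclideanSpace ℝ (Fin m)))
  | .neg => inferInstanceAs (IsManifold (𝓡 m) k (Hyperbolic m))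
  | .pos =>
    isManifold_sphere m k

/-- The metric of the unit sphere, induced by the Euclidean inner product. -/
def sphereMetric (m : ℕ) :
    TensorField (𝓡 m) (Metric.sphere (0 : EuclideanSpace ℝ (Fin (m + 1))) 1) := fun x =>
  (innerₗ (EuclideanSpace ℝ (Fin (m + 1)))).compl₁₂
    (mfderiv (𝓡 m) 𝓘(ℝ, EuclideanSpace ℝ (Fin (m + 1)))
      (Subtype.val : Metric.sphere (0 : EuclideanSpace ℝ (Fin (m + 1))) 1 → _) x).toLinearMap
    (mfderiv (𝓡 m) 𝓘(ℝ, EuclideanSpace ℝ (Fin (m + 1)))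
      (Subtype.val : Metric.sphere (0 : EuclideanSpace ℝ (Fin (m + 1))) 1 → _) x).toLinearMap

/-- The Riemannian metric of the space form. -/
def metric (m : ℕ) : (c : SignType) → TensorField (𝓡 m) (SpaceForm m c)
  | .zero => fun _ => innerₗ (EuclideanSpace ℝ (Fin m))
  | .neg => Hyperbolic.metric m
  | .pos => sphereMetric m

end SpaceForm

/-! ### Robertson-Walker spaces -/

/-- The warped product metric `w(t)² g - dt²` on `Q × J`, where `J` is an open subset of `ℝ`. -/
def warpedMetric {E : Type*} [NormedAddCommGroup E] [NormedSpace ℝ E]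
    {H : Type*} [TopologicalSpace H] {I : ModelWithCorners ℝ E H}
    {Q : Type*} [TopologicalSpace Q] [ChartedSpace H Q]
    (g : TensorField I Q) (J : TopologicalSpace.Opens ℝ) (w : ℝ → ℝ) :
    TensorField (I.prod 𝓘(ℝ, ℝ)) (Q × J) := fun p =>
  (w p.2) ^ 2 • (g p.1).compl₁₂
      (mfderiv (I.prod 𝓘(ℝ, ℝ)) I (Prod.fst : Q × J → Q) p).toLinearMap
      (mfderiv (I.prod 𝓘(ℝ, ℝ)) I (Prod.fst : Q × J → Q) p).toLinearMap
    - (LinearMap.mul ℝ ℝ).compl₁₂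
      (mfderiv (I.prod 𝓘(ℝ, ℝ)) 𝓘(ℝ, ℝ) (fun q : Q × J => (q.2 : ℝ)) p).toLinearMap
      (mfderiv (I.prod 𝓘(ℝ, ℝ)) 𝓘(ℝ, ℝ) (fun q : Q × J => (q.2 : ℝ)) p).toLinearMap

/-- The metric of the Robertson-Walker space `ℚ^m_c ×_w J`. -/
def metric (m : ℕ) (c : SignType) (J : TopologicalSpace.Opens ℝ) (w : ℝ → ℝ) :
    TensorField ((𝓡 m).prod 𝓘(ℝ, ℝ)) (SpaceForm m c × J) :=
  warpedMetric (SpaceForm.metric m c) J w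

end RobertsonWalker

end

/-! The slice `{t = T}` is umbilic. For horizontal `u`, `v` the warped Christoffel vector is the one
of the space form plus the time component `w w' g(u, v)`. Tracing with the induced metric `w² g`
shows that the slice immersion has mean curvature vector `(w⁻² H_φ, w' / w)`
(`meanCurvatureVector_slice`), of squared length `(|H_φ|² - w'²) / w²`. Hence marginally trapped
means `|H_φ|² = w'(T)²`.

In codimension one `H_φ = ⟨H_φ, ν⟩ ν`, so this says `⟨H_φ, ν⟩ = ± w'(T)` for every unit normal. What
remains is to choose the sign continuously. If `w'(T) ≠ 0`, the quotient `⟨H_φ, ν₀⟩ / w'(T)` is a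
continuous function with values `±1`, and multiplying `ν₀` by it corrects the sign; if `w'(T) = 0`,
any `ν₀` works (`exists_unitNormalField_meanCurvature_eq`). Globally `ν₀` is given, locally it is
constructed (`exists_local_unitNormalField`).

Continuity of `⟨H_φ, ν₀⟩` is the delicate point, since `H_φ` at `x` is computed in the preferred
chart at `x`, which may jump with `x`. All three space forms carry a metric induced by a constant
bilinear form `B` on a vector space through a map `ι` (`IsInducedMetric`). Then `⟨H_φ, ν⟩` is a
trace of ordinary second derivatives of `ι ∘ φ` paired with `dι ν`, and this trace does not depend
on the chart (`flatTraceHessian_comp`), so one chart serves a whole neighbourhood. -/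

noncomputable section

namespace RobertsonWalker

/-! ### Second derivatives of composites and of pulled-back bilinear forms. -/

section Calculus

variable {E F G : Type*} [NormedAddCommGroup E] [NormedSpace ℝ E]
  [NormedAddCommGroup F] [NormedSpace ℝ F] [NormedAddCommGroup G] [NormedSpace ℝ G]

theorem fderiv_fderiv_comp {f : F → G} {h : E → F} {x : E}
    (hf : ContDiffAt ℝ 2 f (h x)) (hh : ContDiffAt ℝ 2 h x) (u v : E) :
    fderiv ℝ (fderiv ℝ (f ∘ h)) x u v =
      fderiv ℝ (fderiv ℝ f) (h x) (fderiv ℝ h x u) (fderiv ℝ h x v) +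
        fderiv ℝ f (h x) (fderiv ℝ (fderiv ℝ h) x u v) := by
  have hev : fderiv ℝ (f ∘ h) =ᶠ[𝓝 x] fun y => (fderiv ℝ f (h y)).comp (fderiv ℝ h y) := by
    have h1 := hh.eventually (by simp)
    have h2 := hh.continuousAt.eventually (hf.eventually (by simp))
    filter_upwards [h1, h2] with y hy1 hy2
    exact fderiv_comp y (hy2.differentiableAt (by simp)) (hy1.differentiableAt (by simp))
  rw [hev.fderiv_eq]
  have d1 : DifferentiableAt ℝ (fderiv ℝ f) (h x) :=
    (hf.fderiv_right (m := 1) (by norm_num)).differentiableAt (by simp)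
  have d2 : DifferentiableAt ℝ (fderiv ℝ h) x :=
    (hh.fderiv_right (m := 1) (by norm_num)).differentiableAt (by simp)
  have d3 : DifferentiableAt ℝ h x := hh.differentiableAt (by simp)
  have d4 := (d1.hasFDerivAt.comp x d3.hasFDerivAt).clm_comp d2.hasFDerivAt
  have := d4.fderiv
  simp only [Function.comp_def] at this
  rw [this]
  simp [add_comm]

theorem fderiv_bilin_fderiv (B : G →L[ℝ] G →L[ℝ] ℝ) {f : F → G} {y : F}
    (hf : ContDiffAt ℝ 2 f y) (u v z : F) :
    fderiv ℝ (fun y' => B (fderiv ℝ f y' u) (fderiv ℝ f y' v)) y z =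
      B (fderiv ℝ (fderiv ℝ f) y z u) (fderiv ℝ f y v) +
        B (fderiv ℝ f y u) (fderiv ℝ (fderiv ℝ f) y z v) := by
  have d1 : DifferentiableAt ℝ (fderiv ℝ f) y :=
    (hf.fderiv_right (m := 1) (by norm_num)).differentiableAt (by simp)
  have d2 := fun a : F => d1.hasFDerivAt.clm_apply (hasFDerivAt_const a y)
  have := (((B.hasFDerivAt).comp y (d2 u)).clm_apply (d2 v)).fderiv
  simp only [Function.comp_def] at this
  rw [this]
  simp [add_comm]

end Calculus

/-! ### Vector-valued functions in the preferred charts. -/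

section CoordRep

variable {k : ℕ} {X : Type*} [TopologicalSpace X] [ChartedSpace (EuclideanSpace ℝ (Fin k)) X]
  {V : Type*} [NormedAddCommGroup V] [NormedSpace ℝ V]

/-- The vector-valued function `f` written in the preferred chart at `p`. -/
def coordRep (f : X → V) (p : X) : EuclideanSpace ℝ (Fin k) → V :=
  f ∘ (extChartAt (𝓡 k) p).symm

theorem contDiffOn_coordRep {r : ℕ∞ω} [IsManifold (𝓡 k) r X] {f : X → V}
    (hf : ContMDiff (𝓡 k) 𝓘(ℝ, V) r f) (p : X) :
    ContDiffOn ℝ r (coordRep f p) (extChartAt (𝓡 k) p).target :=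
  contMDiffOn_iff_contDiffOn.1 (hf.comp_contMDiffOn (contMDiffOn_extChartAt_symm p))

theorem contDiffAt_coordRep {r : ℕ∞ω} [IsManifold (𝓡 k) r X] {f : X → V}
    (hf : ContMDiff (𝓡 k) 𝓘(ℝ, V) r f) {p : X} {y : EuclideanSpace ℝ (Fin k)}
    (hy : y ∈ (extChartAt (𝓡 k) p).target) : ContDiffAt ℝ r (coordRep f p) y :=
  (contDiffOn_coordRep hf p).contDiffAt ((isOpen_extChartAt_target p).mem_nhds hy)

theorem fderiv_coordRep_self {f : X → V} {p : X}
    (hf : MDifferentiableAt (𝓡 k) 𝓘(ℝ, V) f p) :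
    fderiv ℝ (coordRep f p) (extChartAt (𝓡 k) p p) = mfderiv (𝓡 k) 𝓘(ℝ, V) f p := by
  refine Eq.trans ?_ hf.mfderiv.symm
  rw [modelWithCornersSelf_coe, Set.range_id, fderivWithin_univ]
  rfl

theorem mdifferentiableAt_extChartAt_symm [IsManifold (𝓡 k) 1 X] {p : X}
    {y : EuclideanSpace ℝ (Fin k)} (hy : y ∈ (extChartAt (𝓡 k) p).target) :
    MDifferentiableAt 𝓘(ℝ, EuclideanSpace ℝ (Fin k)) (𝓡 k) (extChartAt (𝓡 k) p).symm y :=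
  ((contMDiffOn_extChartAt_symm (n := 1) p).contMDiffAt
    ((isOpen_extChartAt_target p).mem_nhds hy)).mdifferentiableAt (by simp)

theorem fderiv_coordRep [IsManifold (𝓡 k) 1 X] {f : X → V} {p : X}
    (hf : MDifferentiable (𝓡 k) 𝓘(ℝ, V) f)
    {y : EuclideanSpace ℝ (Fin k)} (hy : y ∈ (extChartAt (𝓡 k) p).target)
    (u : EuclideanSpace ℝ (Fin k)) :
    fderiv ℝ (coordRep f p) y u = mfderiv (𝓡 k) 𝓘(ℝ, V) f ((extChartAt (𝓡 k) p).symm y)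
      (mfderiv 𝓘(ℝ, EuclideanSpace ℝ (Fin k)) (𝓡 k) (extChartAt (𝓡 k) p).symm y u) := by
  rw [← mfderiv_eq_fderiv, coordRep, mfderiv_comp y (hf _) (mdifferentiableAt_extChartAt_symm hy)]
  rfl

theorem mfderiv_eq_fderiv_coordRep [IsManifold (𝓡 k) 1 X] {f : X → V} {p x : X}
    (hf : MDifferentiable (𝓡 k) 𝓘(ℝ, V) f) (hx : x ∈ (extChartAt (𝓡 k) p).source)
    (u : TangentSpace (𝓡 k) x) :
    mfderiv (𝓡 k) 𝓘(ℝ, V) f x u = fderiv ℝ (coordRep f p) (extChartAt (𝓡 k) p x)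
      (mfderiv (𝓡 k) 𝓘(ℝ, EuclideanSpace ℝ (Fin k)) (extChartAt (𝓡 k) p) x u) := by
  have hy := (extChartAt (𝓡 k) p).map_source hx
  have hev : f =ᶠ[𝓝 x] coordRep f p ∘ extChartAt (𝓡 k) p := by
    filter_upwards [(isOpen_extChartAt_source (I := 𝓡 k) p).mem_nhds hx] with z hz
    exact congrArg f ((extChartAt (𝓡 k) p).left_inv hz).symm
  have h1 : MDifferentiableAt 𝓘(ℝ, EuclideanSpace ℝ (Fin k)) 𝓘(ℝ, V) (coordRep f p)
      (extChartAt (𝓡 k) p x) :=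
    MDifferentiableAt.comp _ (hf _) (mdifferentiableAt_extChartAt_symm hy)
  have h2 : MDifferentiableAt (𝓡 k) 𝓘(ℝ, EuclideanSpace ℝ (Fin k)) (extChartAt (𝓡 k) p) x :=
    mdifferentiableAt_extChartAt (by simpa using hx)
  rw [hev.mfderiv_eq, mfderiv_comp x h1 h2, ← mfderiv_eq_fderiv]
  rfl

end CoordRep

/-! ### Traces, representation of functionals, hyperplanes. -/

section LinearAlgebra

/-- With `Q` the matrix of `P`, both forms change by `Qᵀ · Q`; after inversion of the Gram matrix
the factors cancel inside the trace by cyclicity. This is the basis-independence of a metric trace.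
-/
theorem gram_trace_comp {ι : Type*} [Fintype ι] [DecidableEq ι] {E : Type*} [AddCommGroup E]
    [Module ℝ E] (e : Module.Basis ι ℝ E) (b a : LinearMap.BilinForm ℝ E) (P : E →ₗ[ℝ] E)
    (hP : Function.Injective P) :
    ∑ i, ∑ j, (Matrix.of fun i j => b (P (e i)) (P (e j)))⁻¹ i j * a (P (e i)) (P (e j)) =
      ∑ i, ∑ j, (Matrix.of fun i j => b (e i) (e j))⁻¹ i j * a (e i) (e j) := by
  have key : ∀ b : LinearMap.BilinForm ℝ E, (Matrix.of fun i j => b (P (e i)) (P (e j))) =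
      (LinearMap.toMatrix e e P).transpose * (Matrix.of fun i j => b (e i) (e j)) *
        LinearMap.toMatrix e e P := by
    intro b
    have h := LinearMap.toMatrix₂_compl₁₂ e e e e b P P
    have h1 : LinearMap.toMatrix₂ e e (b.compl₁₂ P P) =
        Matrix.of fun i j => b (P (e i)) (P (e j)) := by
      ext i j; rw [LinearMap.toMatrix₂_apply]; rfl
    have h2 : LinearMap.toMatrix₂ e e b = Matrix.of fun i j => b (e i) (e j) := by
      ext i j; rw [LinearMap.toMatrix₂_apply]; rfl
    rw [← h1, h, h2]
  have tr : ∀ A C : Matrix ι ι ℝ, ∑ i, ∑ j, A i j * C i j = (A * C.transpose).trace := by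
    intro A C
    simp only [Matrix.trace, Matrix.diag_apply, Matrix.mul_apply, Matrix.transpose_apply]
  set Q := LinearMap.toMatrix e e P
  have hQ : IsUnit Q.det := by
    have : FiniteDimensional ℝ E := Module.Basis.finiteDimensional_of_finite e
    rw [LinearMap.det_toMatrix]
    exact LinearEquiv.isUnit_det' (LinearEquiv.ofInjectiveEndo P hP)
  have hQt : IsUnit Q.transpose.det := by rwa [Matrix.det_transpose]
  refine (tr _ (Matrix.of fun i j => a (P (e i)) (P (e j)))).trans
    (Eq.trans ?_ (tr _ (Matrix.of fun i j => a (e i) (e j))).symm)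
  rw [key b, key a]
  set S := Matrix.of fun i j => b (e i) (e j)
  set R := Matrix.of fun i j => a (e i) (e j)
  rw [Matrix.mul_inv_rev, Matrix.mul_inv_rev, Matrix.transpose_mul, Matrix.transpose_mul,
    Matrix.transpose_transpose]
  have : Q⁻¹ * (S⁻¹ * Q.transpose⁻¹) * (Q.transpose * (R.transpose * Q)) =
      Q⁻¹ * (S⁻¹ * R.transpose * Q) := by
    simp only [Matrix.mul_assoc]
    rw [← Matrix.mul_assoc Q.transpose⁻¹, Matrix.nonsing_inv_mul _ hQt, Matrix.one_mul]
  rw [this, Matrix.trace_mul_comm, Matrix.mul_assoc, Matrix.mul_nonsing_inv _ hQ, Matrix.mul_one]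

/-- Anisotropy makes `b` injective into the dual, hence onto by dimension. -/
theorem exists_repr_of_anisotropic {E : Type*} [AddCommGroup E] [Module ℝ E]
    [FiniteDimensional ℝ E] (b : LinearMap.BilinForm ℝ E) (hb : ∀ u, b u u = 0 → u = 0)
    (l : E →ₗ[ℝ] ℝ) : ∃ a, ∀ z, b a z = l z := by
  have hinj : Function.Injective b := by
    rw [injective_iff_map_eq_zero]
    intro u hu
    exact hb u (by simp [hu])
  have hs := (LinearMap.injective_iff_surjective_of_finrank_eq_finrank
    (f := b) (by rw [Subspace.dual_finrank_eq])).1 hinj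
  obtain ⟨a, ha⟩ := hs l
  exact ⟨a, fun z => by rw [ha]⟩

/-- By dimension `ν` and the range of `d` span `F`. Expanding one argument of `b ξ ξ` accordingly
gives `0`. -/
theorem eq_zero_of_orthogonal_hyperplane {E F : Type*} [AddCommGroup E] [Module ℝ E]
    [AddCommGroup F] [Module ℝ F] [FiniteDimensional ℝ E] [FiniteDimensional ℝ F]
    (hdim : Module.finrank ℝ F = Module.finrank ℝ E + 1)
    (b : LinearMap.BilinForm ℝ F) (hb : ∀ u, b u u = 0 → u = 0)
    (d : E →ₗ[ℝ] F) (hd : Function.Injective d) {ν ξ : F} (hν : b ν ν ≠ 0)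
    (hνd : ∀ u, b ν (d u) = 0) (hξd : ∀ u, b ξ (d u) = 0) (hξν : b ξ ν = 0) : ξ = 0 := by
  let L : E × ℝ →ₗ[ℝ] F := d.coprod (LinearMap.toSpanSingleton ℝ F ν)
  have hL : Function.Injective L := by
    rw [injective_iff_map_eq_zero]
    rintro ⟨u, t⟩ h
    simp only [L, LinearMap.coprod_apply, LinearMap.toSpanSingleton_apply] at h
    have h1 : b ν (d u + t • ν) = 0 := by rw [h, map_zero]
    rw [map_add, hνd, map_smul, smul_eq_mul, zero_add] at h1
    have ht : t = 0 := by simpa [hν] using h1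
    subst ht
    rw [zero_smul, add_zero] at h
    have := hd (h.trans (map_zero d).symm)
    simp [this]
  have hs := (LinearMap.injective_iff_surjective_of_finrank_eq_finrank
    (f := L) (by simp [hdim])).1 hL
  obtain ⟨⟨u, t⟩, h⟩ := hs ξ
  apply hb
  conv_lhs => rw [← h]
  simp only [L, LinearMap.coprod_apply, LinearMap.toSpanSingleton_apply]
  have hL' : d u + t • ν = ξ := h
  rw [hL', ← hL', map_add (b (d u + t • ν)), hL', hξd, map_smul, hξν]
  simp

end LinearAlgebra

/-! ### Normal projection and mean curvature at a point. -/

section Pointwise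

variable {E : Type*} [NormedAddCommGroup E] [NormedSpace ℝ E]
  {H : Type*} [TopologicalSpace H] {I : ModelWithCorners ℝ E H}
  {N : Type*} [TopologicalSpace N] [ChartedSpace H N]
  {n : ℕ} {M : Type*} [TopologicalSpace M] [ChartedSpace (EuclideanSpace ℝ (Fin n)) M]

theorem christoffel_eq {g : TensorField I N} {p : N} {u v a : TangentSpace I p}
    (hnd : ∀ a b : TangentSpace I p, (∀ z, g p a z = g p b z) → a = b)
    (ha : ∀ z : TangentSpace I p, g p a z = christoffelFirst g p u v z) :
    christoffel g p u v = a := by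
  have h : ∃ a : TangentSpace I p, ∀ z : TangentSpace I p,
    g p a z = christoffelFirst g p u v z := ⟨a, ha⟩
  rw [christoffel, dif_pos h]
  exact hnd _ _ fun z => (h.choose_spec z).trans (ha z).symm

/-- The metric induced by `f` at `x` has no null vectors. -/
def IsAnisotropicAt (g : TensorField I N) (f : M → N) (x : M) : Prop :=
  ∀ u : TangentSpace (𝓡 n) x,
    g (f x) (mfderiv (𝓡 n) I f x u) (mfderiv (𝓡 n) I f x u) = 0 → u = 0

/-- Two decompositions differ by a tangent vector that is also normal, hence null for the induced
metric, hence zero. So any explicit decomposition identifies the chosen one. -/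
theorem normalPart_eq {g : TensorField I N} {f : M → N} {x : M}
    (hf : IsAnisotropicAt (n := n) g f x) {ξ η : TangentSpace I (f x)}
    (hη : IsNormal (n := n) g f x η) {u : TangentSpace (𝓡 n) x}
    (hu : ξ = mfderiv (𝓡 n) I f x u + η) : normalPart (n := n) g f x ξ = η := by
  have h : ∃ η : TangentSpace I (f x), IsNormal (n := n) g f x η ∧
    ∃ u : TangentSpace (𝓡 n) x, ξ = mfderiv (𝓡 n) I f x u + η := ⟨η, hη, u, hu⟩
  rw [normalPart, dif_pos h]
  obtain ⟨h1, u', h2⟩ := h.choose_spec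
  set η' := h.choose
  have e : η' - η = mfderiv (𝓡 n) I f x (u - u') := by
    rw [map_sub, sub_eq_sub_iff_add_eq_add, add_comm, ← h2, hu]
  have hz : u - u' = 0 := by
    apply hf
    rw [← e, map_sub (g (f x)), LinearMap.sub_apply]
    rw [e, h1, hη, sub_zero]
  rw [hz, map_zero, sub_eq_zero] at e
  exact e

/-- The tangential part is the vector representing `g ξ` on the tangent space of `M`. -/
theorem exists_normal_decomposition {g : TensorField I N} {f : M → N} {x : M}
    (hf : IsAnisotropicAt (n := n) g f x) (ξ : TangentSpace I (f x)) :
    ∃ η, IsNormal (n := n) g f x η ∧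
      ∃ u : TangentSpace (𝓡 n) x, ξ = mfderiv (𝓡 n) I f x u + η := by
  let d : TangentSpace (𝓡 n) x →ₗ[ℝ] TangentSpace I (f x) := (mfderiv (𝓡 n) I f x).toLinearMap
  have : FiniteDimensional ℝ (TangentSpace (𝓡 n) x) :=
    inferInstanceAs (FiniteDimensional ℝ (EuclideanSpace ℝ (Fin n)))
  obtain ⟨u, hu⟩ := exists_repr_of_anisotropic ((g (f x)).compl₁₂ d d) hf ((g (f x) ξ).comp d)
  refine ⟨ξ - mfderiv (𝓡 n) I f x u, fun v => ?_, u, by abel⟩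
  have := hu v
  rw [map_sub, LinearMap.sub_apply, sub_eq_zero]
  exact this.symm

theorem isNormal_normalPart {g : TensorField I N} {f : M → N} {x : M}
    (hf : IsAnisotropicAt (n := n) g f x) (ξ : TangentSpace I (f x)) :
    IsNormal (n := n) g f x (normalPart (n := n) g f x ξ) := by
  obtain ⟨η, hη, u, hu⟩ := exists_normal_decomposition hf ξ
  rwa [normalPart_eq hf hη hu]

/-- The discarded part is tangential, so against normal vectors the projection can be omitted. -/
theorem normalPart_pairing {g : TensorField I N} {f : M → N} {x : M}
    (hsymm : ∀ a b, g (f x) a b = g (f x) b a)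
    (hf : IsAnisotropicAt (n := n) g f x) (ξ : TangentSpace I (f x)) {ν : TangentSpace I (f x)}
    (hν : IsNormal (n := n) g f x ν) :
    g (f x) (normalPart (n := n) g f x ξ) ν = g (f x) ξ ν := by
  obtain ⟨η, hη, u, hu⟩ := exists_normal_decomposition hf ξ
  rw [normalPart_eq hf hη hu, hu, map_add, LinearMap.add_apply, hsymm (mfderiv (𝓡 n) I f x u), hν,
    zero_add]

theorem isNormal_meanCurvatureVector {g : TensorField I N} {f : M → N} {x : M}
    (hf : IsAnisotropicAt (n := n) g f x) :
    IsNormal (n := n) g f x (meanCurvatureVector (n := n) g f x) := by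
  intro u
  simp only [meanCurvatureVector, map_smul, map_sum, LinearMap.smul_apply, LinearMap.sum_apply,
    secondFundamentalForm, isNormal_normalPart hf _ u, smul_zero, Finset.sum_const_zero]

theorem meanCurvatureVector_pairing {g : TensorField I N} {f : M → N} {x : M}
    (hsymm : ∀ a b, g (f x) a b = g (f x) b a)
    (hf : IsAnisotropicAt (n := n) g f x) {ν : TangentSpace I (f x)}
    (hν : IsNormal (n := n) g f x ν) :
    g (f x) (meanCurvatureVector (n := n) g f x) ν =
      (1 / (n : ℝ)) * ∑ i : Fin n, ∑ j : Fin n, (gramMatrix g f x)⁻¹ i j *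
        g (f x) (covariantHessian g f x (coordVec x i) (coordVec x j)) ν := by
  simp only [meanCurvatureVector, map_smul, map_sum, LinearMap.smul_apply, LinearMap.sum_apply,
    secondFundamentalForm, normalPart_pairing hsymm hf _ hν, smul_eq_mul]

end Pointwise

/-! ### Christoffel symbols of a metric induced from a flat space. -/

section InducedMetric

variable {m : ℕ} {Q : Type*} [TopologicalSpace Q] [ChartedSpace (EuclideanSpace ℝ (Fin m)) Q]
  {V : Type*} [NormedAddCommGroup V] [NormedSpace ℝ V]

/-- The metric `g` on `Q` is positive definite and is induced, through the smooth map `ι`, by the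
constant symmetric bilinear form `B` on `V`. -/
structure IsInducedMetric (g : TensorField (𝓡 m) Q) (ι : Q → V) (B : V →L[ℝ] V →L[ℝ] ℝ) :
    Prop where
  smooth : ContMDiff (𝓡 m) 𝓘(ℝ, V) ∞ ι
  bilin_symm : ∀ a b, B a b = B b a
  metric_eq : ∀ (p : Q) (u v : TangentSpace (𝓡 m) p),
    g p u v = B (mfderiv (𝓡 m) 𝓘(ℝ, V) ι p u) (mfderiv (𝓡 m) 𝓘(ℝ, V) ι p v)
  pos : ∀ (p : Q) (u : TangentSpace (𝓡 m) p), u ≠ 0 → 0 < g p u u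

namespace IsInducedMetric

variable {g : TensorField (𝓡 m) Q} {ι : Q → V} {B : V →L[ℝ] V →L[ℝ] ℝ}

theorem symm (hg : IsInducedMetric g ι B) (p : Q) (u v : TangentSpace (𝓡 m) p) :
    g p u v = g p v u := by
  rw [hg.metric_eq, hg.metric_eq]
  exact hg.bilin_symm _ _

theorem mdifferentiable (hg : IsInducedMetric g ι B) : MDifferentiable (𝓡 m) 𝓘(ℝ, V) ι :=
  hg.smooth.mdifferentiable (by simp)

theorem eq_zero (hg : IsInducedMetric g ι B) {p : Q} {u : TangentSpace (𝓡 m) p}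
    (h : g p u u = 0) : u = 0 := by
  by_contra hu
  exact (hg.pos p u hu).ne' h

theorem nondegenerate (hg : IsInducedMetric g ι B) {p : Q} (a b : TangentSpace (𝓡 m) p)
    (h : ∀ z, g p a z = g p b z) : a = b := by
  rw [← sub_eq_zero]
  apply hg.eq_zero
  rw [map_sub (g p), LinearMap.sub_apply, h, sub_self]

variable [IsManifold (𝓡 m) ∞ Q]

theorem metricInChart_eq (hg : IsInducedMetric g ι B) (p : Q)
    (u v : EuclideanSpace ℝ (Fin m)) {y : EuclideanSpace ℝ (Fin m)}
    (hy : y ∈ (extChartAt (𝓡 m) p).target) :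
    metricInChart g p u v y =
      B (fderiv ℝ (coordRep ι p) y u) (fderiv ℝ (coordRep ι p) y v) := by
  rw [metricInChart, hg.metric_eq, fderiv_coordRep hg.mdifferentiable hy,
    fderiv_coordRep hg.mdifferentiable hy]

theorem metricInChart_eventuallyEq (hg : IsInducedMetric g ι B) (p : Q)
    (u v : EuclideanSpace ℝ (Fin m)) :
    metricInChart g p u v =ᶠ[𝓝 (extChartAt (𝓡 m) p p)] fun y =>
      B (fderiv ℝ (coordRep ι p) y u) (fderiv ℝ (coordRep ι p) y v) := by
  filter_upwards [(isOpen_extChartAt_target (I := 𝓡 m) p).mem_nhds (mem_extChartAt_target p)]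
    with y hy using hg.metricInChart_eq p u v hy

theorem metricInChart_self (hg : IsInducedMetric g ι B) (p : Q) (u v : TangentSpace (𝓡 m) p) :
    metricInChart g p u v (extChartAt (𝓡 m) p p) = g p u v := by
  rw [hg.metricInChart_eq p u v (mem_extChartAt_target p),
    fderiv_coordRep_self (hg.mdifferentiable p), hg.metric_eq]
  rfl

theorem contDiffAt_coordRep_self (hg : IsInducedMetric g ι B) (p : Q) :
    ContDiffAt ℝ 2 (coordRep ι p) (extChartAt (𝓡 m) p p) :=
  contDiffAt_coordRep (hg.smooth.of_le (WithTop.coe_le_coe.2 le_top)) (mem_extChartAt_target p)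

theorem differentiableAt_metricInChart (hg : IsInducedMetric g ι B) (p : Q)
    (u v : EuclideanSpace ℝ (Fin m)) :
    DifferentiableAt ℝ (metricInChart g p u v) (extChartAt (𝓡 m) p p) := by
  rw [(hg.metricInChart_eventuallyEq p u v).differentiableAt_iff]
  have d1 : DifferentiableAt ℝ (fderiv ℝ (coordRep ι p)) (extChartAt (𝓡 m) p p) :=
    ((hg.contDiffAt_coordRep_self p).fderiv_right (m := 1) (by norm_num)).differentiableAt
      (by simp)
  fun_prop

/-- The product rule produces six terms; symmetry of second derivatives and of `B` cancels four and
makes the other two equal. -/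
theorem christoffelFirst_eq (hg : IsInducedMetric g ι B) (p : Q)
    (u v z : EuclideanSpace ℝ (Fin m)) :
    christoffelFirst g p u v z =
      B (fderiv ℝ (fderiv ℝ (coordRep ι p)) (extChartAt (𝓡 m) p p) u v)
        (fderiv ℝ (coordRep ι p) (extChartAt (𝓡 m) p p) z) := by
  have hF := hg.contDiffAt_coordRep_self p
  have hs : IsSymmSndFDerivAt ℝ (coordRep ι p) (extChartAt (𝓡 m) p p) :=
    hF.isSymmSndFDerivAt (by simp)
  rw [christoffelFirst, (hg.metricInChart_eventuallyEq p v z).fderiv_eq,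
    (hg.metricInChart_eventuallyEq p u z).fderiv_eq,
    (hg.metricInChart_eventuallyEq p u v).fderiv_eq, fderiv_bilin_fderiv B hF,
    fderiv_bilin_fderiv B hF, fderiv_bilin_fderiv B hF, hs u z, hs v z, hs v u,
    hg.bilin_symm (fderiv ℝ (coordRep ι p) (extChartAt (𝓡 m) p p) v),
    hg.bilin_symm (fderiv ℝ (coordRep ι p) (extChartAt (𝓡 m) p p) u)]
  ring

/-- By `christoffelFirst_eq` the symbol of the first kind is linear in `z`, so positivity provides
the representing vector and the default value `0` is not used. -/
theorem metric_christoffel (hg : IsInducedMetric g ι B) (p : Q)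
    (u v z : TangentSpace (𝓡 m) p) :
    g p (christoffel g p u v) z = christoffelFirst g p u v z := by
  have : FiniteDimensional ℝ (TangentSpace (𝓡 m) p) :=
    inferInstanceAs (FiniteDimensional ℝ (EuclideanSpace ℝ (Fin m)))
  let l : TangentSpace (𝓡 m) p →ₗ[ℝ] ℝ :=
    ((B (fderiv ℝ (fderiv ℝ (coordRep ι p)) (extChartAt (𝓡 m) p p) u v)).comp
        (fderiv ℝ (coordRep ι p) (extChartAt (𝓡 m) p p))).toLinearMap
  obtain ⟨a, ha⟩ := exists_repr_of_anisotropic (g p) (fun u => hg.eq_zero) l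
  have ha' : ∀ z, g p a z = christoffelFirst g p u v z := fun z =>
    (ha z).trans (hg.christoffelFirst_eq p u v z).symm
  rw [christoffel_eq hg.nondegenerate ha', ha']

end IsInducedMetric

end InducedMetric

/-! ### The metric trace of the second derivative of a map into a flat space. -/

section TraceHessian

variable {n : ℕ} {V : Type*} [NormedAddCommGroup V] [NormedSpace ℝ V]

/-- The Gram matrix, in the coordinate basis, of the form induced by `B` through `Φ`. -/
def flatGram (B : V →L[ℝ] V →L[ℝ] ℝ) (Φ : EuclideanSpace ℝ (Fin n) → V)
    (y : EuclideanSpace ℝ (Fin n)) : Matrix (Fin n) (Fin n) ℝ :=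
  Matrix.of fun i j => B (fderiv ℝ Φ y (EuclideanSpace.single i 1))
    (fderiv ℝ Φ y (EuclideanSpace.single j 1))

/-- The trace, with respect to the form induced by `B` through `Φ`, of the second derivative of `Φ`
paired with `a`. -/
def flatTraceHessian (B : V →L[ℝ] V →L[ℝ] ℝ) (Φ : EuclideanSpace ℝ (Fin n) → V)
    (y : EuclideanSpace ℝ (Fin n)) (a : V) : ℝ :=
  ∑ i : Fin n, ∑ j : Fin n, (flatGram B Φ y)⁻¹ i j *
    B (fderiv ℝ (fderiv ℝ Φ) y (EuclideanSpace.single i 1) (EuclideanSpace.single j 1)) a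

/-- The second-order chain rule adds the term `DΦ (D²τ)`, which is tangential and so invisible to
the normal vector `a`. The rest is a change of basis by the injective map `Dτ`, covered by
`gram_trace_comp`. -/
theorem flatTraceHessian_comp (B : V →L[ℝ] V →L[ℝ] ℝ) {Φ : EuclideanSpace ℝ (Fin n) → V}
    {τ : EuclideanSpace ℝ (Fin n) → EuclideanSpace ℝ (Fin n)} {y : EuclideanSpace ℝ (Fin n)}
    (hΦ : ContDiffAt ℝ 2 Φ (τ y)) (hτ : ContDiffAt ℝ 2 τ y)
    (hinj : Function.Injective (fderiv ℝ (Φ ∘ τ) y)) {a : V}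
    (ha : ∀ v, B (fderiv ℝ Φ (τ y) v) a = 0) :
    flatTraceHessian B (Φ ∘ τ) y a = flatTraceHessian B Φ (τ y) a := by
  have hD : fderiv ℝ (Φ ∘ τ) y = (fderiv ℝ Φ (τ y)).comp (fderiv ℝ τ y) :=
    fderiv_comp y (hΦ.differentiableAt (by simp)) (hτ.differentiableAt (by simp))
  have hP : Function.Injective (fderiv ℝ τ y) := by
    rw [hD, ContinuousLinearMap.coe_comp] at hinj
    exact hinj.of_comp
  let D := fderiv ℝ Φ (τ y)
  let b : LinearMap.BilinForm ℝ (EuclideanSpace ℝ (Fin n)) :=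
    LinearMap.mk₂ ℝ (fun u v => B (D u) (D v)) (by simp) (by simp) (by simp) (by simp)
  let h : LinearMap.BilinForm ℝ (EuclideanSpace ℝ (Fin n)) :=
    LinearMap.mk₂ ℝ (fun u v => B (fderiv ℝ (fderiv ℝ Φ) (τ y) u v) a)
      (by simp) (by simp) (by simp) (by simp)
  have key := gram_trace_comp (EuclideanSpace.basisFun (Fin n) ℝ).toBasis b h
    (fderiv ℝ τ y).toLinearMap hP
  simp only [OrthonormalBasis.coe_toBasis, EuclideanSpace.basisFun_apply] at key
  rw [flatTraceHessian, flatTraceHessian]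
  simp only [fderiv_fderiv_comp hΦ hτ, map_add, add_apply, ha, add_zero,
    flatGram, hD]
  exact key

/-- A kernel vector `c` of the Gram matrix gives the null vector with coordinates `c`. -/
theorem det_flatGram_ne_zero (B : V →L[ℝ] V →L[ℝ] ℝ) {Φ : EuclideanSpace ℝ (Fin n) → V}
    {y : EuclideanSpace ℝ (Fin n)}
    (h : ∀ u, B (fderiv ℝ Φ y u) (fderiv ℝ Φ y u) = 0 → u = 0) :
    (flatGram B Φ y).det ≠ 0 := by
  intro h0
  obtain ⟨c, hc, hc0⟩ := Matrix.exists_mulVec_eq_zero_iff.2 h0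
  apply hc
  have hu : WithLp.toLp 2 c = ∑ i, c i • EuclideanSpace.single (𝕜 := ℝ) i (1 : ℝ) := by
    ext j
    simp [Finset.sum_apply, Pi.single_apply]
  have h1 : (WithLp.toLp 2 c : EuclideanSpace ℝ (Fin n)) = 0 := by
    apply h
    rw [hu]
    have h2 : ∑ i, c i * (flatGram B Φ y).mulVec c i = 0 := by simp [hc0]
    rw [← h2]
    simp only [map_sum, map_smul, sum_apply, smul_apply,
      smul_eq_mul, Matrix.mulVec, dotProduct, flatGram, Matrix.of_apply, Finset.mul_sum]
    rw [Finset.sum_comm]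
    refine Finset.sum_congr rfl fun i _ => Finset.sum_congr rfl fun j _ => ?_
    ring
  ext i
  exact congrArg (fun v : EuclideanSpace ℝ (Fin n) => v i) h1

/-- Two continuous derivatives suffice, together with continuity of matrix inversion where the
determinant does not vanish. -/
theorem continuousAt_flatTraceHessian (B : V →L[ℝ] V →L[ℝ] ℝ) {Φ : EuclideanSpace ℝ (Fin n) → V}
    {y : EuclideanSpace ℝ (Fin n)} (hΦ : ContDiffAt ℝ 2 Φ y)
    (h : ∀ u, B (fderiv ℝ Φ y u) (fderiv ℝ Φ y u) = 0 → u = 0) (a : V) :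
    ContinuousAt (fun q : EuclideanSpace ℝ (Fin n) × V => flatTraceHessian B Φ q.1 q.2) (y, a) := by
  have c0 : ContDiffAt ℝ 1 (fderiv ℝ Φ) y := hΦ.fderiv_right (by norm_num)
  have c1 : ContinuousAt (fderiv ℝ Φ) y := c0.continuousAt
  have c2 : ContinuousAt (fderiv ℝ (fderiv ℝ Φ)) y :=
    (c0.fderiv_right (m := 0) (by norm_num)).continuousAt
  have cG : ContinuousAt (flatGram B Φ) y := by
    refine continuousAt_pi.2 fun i => continuousAt_pi.2 fun j => ?_
    exact ((B.continuous.continuousAt.comp (c1.clm_apply continuousAt_const)).clm_apply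
      (c1.clm_apply continuousAt_const))
  have cI : ContinuousAt (fun z => (flatGram B Φ z)⁻¹) y := by
    refine ContinuousAt.comp (g := Inv.inv) (continuousAt_matrix_inv _ ?_) cG
    have := (NormedRing.inverse_continuousAt (Units.mk0 _ (det_flatGram_ne_zero B h)))
    exact this
  have cf : ContinuousAt (Prod.fst : EuclideanSpace ℝ (Fin n) × V → _) (y, a) := continuousAt_fst
  unfold flatTraceHessian
  refine tendsto_finsetSum _ fun i _ => tendsto_finsetSum _ fun j _ => ?_
  refine ContinuousAt.mul ?_ ?_
  · exact ContinuousAt.comp (x := (y, a)) (f := Prod.fst) (g := fun z => (flatGram B Φ z)⁻¹ i j)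
      (continuousAt_pi.1 (continuousAt_pi.1 cI i) j) cf
  · have c3 : ContinuousAt (fun z => fderiv ℝ (fderiv ℝ Φ) z (EuclideanSpace.single i 1)
        (EuclideanSpace.single j 1)) y :=
      (c2.clm_apply continuousAt_const).clm_apply continuousAt_const
    have c4 := ContinuousAt.comp (x := (y, a)) (f := Prod.fst) c3 cf
    exact (B.continuous.continuousAt.comp c4).clm_apply continuousAt_snd

end TraceHessian

/-! ### The covariant Hessian through the flat ambient space. -/

namespace IsInducedMetric

variable {m : ℕ} {Q : Type*} [TopologicalSpace Q] [ChartedSpace (EuclideanSpace ℝ (Fin m)) Q]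
  {V : Type*} [NormedAddCommGroup V] [NormedSpace ℝ V]
  {g : TensorField (𝓡 m) Q} {ι : Q → V} {B : V →L[ℝ] V →L[ℝ] ℝ} {n : ℕ} {M : Type*} [TopologicalSpace M] [ChartedSpace (EuclideanSpace ℝ (Fin n)) M]
  {φ : M → Q}

theorem contMDiff_comp (hg : IsInducedMetric g ι B) (hφ : ContMDiff (𝓡 n) (𝓡 m) 2 φ) :
    ContMDiff (𝓡 n) 𝓘(ℝ, V) 2 (ι ∘ φ) :=
  (hg.smooth.of_le (WithTop.coe_le_coe.2 le_top)).comp hφ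

theorem mfderiv_comp_apply (hg : IsInducedMetric g ι B) (hφ : ContMDiff (𝓡 n) (𝓡 m) 2 φ) (x : M)
    (u : TangentSpace (𝓡 n) x) :
    mfderiv (𝓡 n) 𝓘(ℝ, V) (ι ∘ φ) x u =
      mfderiv (𝓡 m) 𝓘(ℝ, V) ι (φ x) (mfderiv (𝓡 n) (𝓡 m) φ x u) := by
  rw [mfderiv_comp x (hg.mdifferentiable _) (hφ.mdifferentiable (by simp) x)]
  rfl

variable [IsManifold (𝓡 m) ∞ Q]

/-- In charts `ι ∘ φ` is `F ∘ h`, with `F` and `h` the local expressions of `ι` and `φ`. In its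
second derivative, `D²F(dφ u, dφ v)` pairs to the Christoffel term and `DF(D²h(u, v))` to the
coordinate second derivative of `φ`. -/
theorem metric_covariantHessian (hg : IsInducedMetric g ι B) (hφ : ContMDiff (𝓡 n) (𝓡 m) 2 φ)
    (x : M) (u v : TangentSpace (𝓡 n) x) (z : TangentSpace (𝓡 m) (φ x)) :
    g (φ x) (covariantHessian g φ x u v) z =
      B (fderiv ℝ (fderiv ℝ (coordRep (ι ∘ φ) x)) (extChartAt (𝓡 n) x x) u v)
        (mfderiv (𝓡 m) 𝓘(ℝ, V) ι (φ x) z) := by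
  have hφx := hφ.contMDiffAt (x := x)
  set h := writtenInExtChartAt (𝓡 n) (𝓡 m) x φ with hh
  have hsm : ContDiffAt ℝ 2 h (extChartAt (𝓡 n) x x) := by
    have := (contMDiffAt_iff.1 hφx).2
    rwa [modelWithCornersSelf_coe, Set.range_id, contDiffWithinAt_univ] at this
  have hval : h (extChartAt (𝓡 n) x x) = extChartAt (𝓡 m) (φ x) (φ x) := by
    simp [hh, writtenInExtChartAt]
  have hD : (fderiv ℝ h (extChartAt (𝓡 n) x x) : _ → _) = mfderiv (𝓡 n) (𝓡 m) φ x := by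
    have := (hφx.mdifferentiableAt (by simp)).mfderiv
    rw [modelWithCornersSelf_coe, Set.range_id, fderivWithin_univ] at this
    rw [this]
    rfl
  have hF := hg.contDiffAt_coordRep_self (φ x)
  have hev : coordRep (ι ∘ φ) x =ᶠ[𝓝 (extChartAt (𝓡 n) x x)] coordRep ι (φ x) ∘ h := by
    have hc : ContinuousAt (φ ∘ (extChartAt (𝓡 n) x).symm) (extChartAt (𝓡 n) x x) := by
      refine ContinuousAt.comp ?_ (continuousAt_extChartAt_symm x)
      rw [(extChartAt (𝓡 n) x).left_inv (mem_extChartAt_source x)]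
      exact hφx.continuousAt
    have := hc.preimage_mem_nhds (t := (extChartAt (𝓡 m) (φ x)).source) (by
      apply (isOpen_extChartAt_source _).mem_nhds
      rw [Function.comp_apply, (extChartAt (𝓡 n) x).left_inv (mem_extChartAt_source x)]
      exact mem_extChartAt_source _)
    filter_upwards [this] with y hy
    exact congrArg ι ((extChartAt (𝓡 m) (φ x)).left_inv hy).symm
  let U : EuclideanSpace ℝ (Fin n) := u
  let W : EuclideanSpace ℝ (Fin n) := v
  have step : fderiv ℝ (fderiv ℝ (coordRep (ι ∘ φ) x)) (extChartAt (𝓡 n) x x) U W =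
      fderiv ℝ (fderiv ℝ (coordRep ι (φ x))) (extChartAt (𝓡 m) (φ x) (φ x))
        (mfderiv (𝓡 n) (𝓡 m) φ x u) (mfderiv (𝓡 n) (𝓡 m) φ x v) +
      fderiv ℝ (coordRep ι (φ x)) (extChartAt (𝓡 m) (φ x) (φ x))
        (fderiv ℝ (fderiv ℝ h) (extChartAt (𝓡 n) x x) U W) := by
    rw [(hev.fderiv (𝕜 := ℝ)).fderiv_eq, fderiv_fderiv_comp (hval ▸ hF) hsm, hval, hD]
  have e1 := hg.christoffelFirst_eq (φ x) (mfderiv (𝓡 n) (𝓡 m) φ x u)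
    (mfderiv (𝓡 n) (𝓡 m) φ x v) z
  rw [fderiv_coordRep_self (hg.mdifferentiable _)] at e1
  have e2 : g (φ x) (fderiv ℝ (fderiv ℝ h) (extChartAt (𝓡 n) x x) U W) z =
      B (fderiv ℝ (coordRep ι (φ x)) (extChartAt (𝓡 m) (φ x) (φ x))
        (fderiv ℝ (fderiv ℝ h) (extChartAt (𝓡 n) x x) U W))
        (mfderiv (𝓡 m) 𝓘(ℝ, V) ι (φ x) z) := by
    rw [fderiv_coordRep_self (hg.mdifferentiable _)]
    exact hg.metric_eq (φ x) _ z
  refine Eq.trans ?_ (congrArg (fun a => B a (mfderiv (𝓡 m) 𝓘(ℝ, V) ι (φ x) z)) step).symm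
  have e3 : ∀ a b : TangentSpace (𝓡 m) (φ x),
      g (φ x) (a + b) z = g (φ x) b z + g (φ x) a z := fun a b => by
    rw [map_add (g (φ x)), LinearMap.add_apply, add_comm]
  refine (e3 _ _).trans ?_
  rw [hg.metric_christoffel]
  have e4 : ∀ a b c : V, B a c + B b c = B (a + b) c := fun a b c => by
    rw [map_add B, add_apply]
  exact (congrArg₂ (· + ·) e1 e2).trans (e4 _ _ _)

end IsInducedMetric

/-! ### Continuity of differentials applied to continuous fields. -/

section TangentBundle

variable {m : ℕ} {Q : Type*} [TopologicalSpace Q] [ChartedSpace (EuclideanSpace ℝ (Fin m)) Q]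
  {V : Type*} [NormedAddCommGroup V] [NormedSpace ℝ V]

theorem continuousOn_mfderiv_apply [IsManifold (𝓡 m) 1 Q] {X : Type*} [TopologicalSpace X]
    {ι : Q → V} (hι : ContMDiff (𝓡 m) 𝓘(ℝ, V) 1 ι) {φ : X → Q}
    {ν : (x : X) → TangentSpace (𝓡 m) (φ x)} {U : Set X}
    (hν : ContinuousOn (fun x => (⟨φ x, ν x⟩ : TangentBundle (𝓡 m) Q)) U) :
    ContinuousOn (fun x => (mfderiv (𝓡 m) 𝓘(ℝ, V) ι (φ x) (ν x) : V)) U := by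
  have h1 := (hι.continuous_tangentMap le_rfl).comp_continuousOn hν
  exact (contMDiff_snd_tangentBundle_modelSpace V 𝓘(ℝ, V) (n := 0)).continuous.comp_continuousOn h1

end TangentBundle

theorem flatTraceHessian_congr {n : ℕ} {V : Type*} [NormedAddCommGroup V] [NormedSpace ℝ V]
    (B : V →L[ℝ] V →L[ℝ] ℝ) {Φ Ψ : EuclideanSpace ℝ (Fin n) → V} {y : EuclideanSpace ℝ (Fin n)}
    (h : Φ =ᶠ[𝓝 y] Ψ) (a : V) : flatTraceHessian B Φ y a = flatTraceHessian B Ψ y a := by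
  rw [flatTraceHessian, flatTraceHessian, (h.fderiv (𝕜 := ℝ)).fderiv_eq, flatGram, flatGram,
    h.fderiv_eq]

/-! ### Mean curvature in a fixed chart and its continuity. -/

namespace IsInducedMetric

variable {m : ℕ} {Q : Type*} [TopologicalSpace Q] [ChartedSpace (EuclideanSpace ℝ (Fin m)) Q]
  {V : Type*} [NormedAddCommGroup V] [NormedSpace ℝ V]
  {g : TensorField (𝓡 m) Q} {ι : Q → V} {B : V →L[ℝ] V →L[ℝ] ℝ}
  {n : ℕ} {M : Type*} [TopologicalSpace M] [ChartedSpace (EuclideanSpace ℝ (Fin n)) M]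
  {φ : M → Q}

theorem isAnisotropicAt (hg : IsInducedMetric g ι B)
    (hφ : IsImmersionOfClass (𝓡 m) n 2 φ) (x : M) : IsAnisotropicAt (n := n) g φ x :=
  fun _ hu => (map_eq_zero_iff _ (hφ.2 x)).1 (hg.eq_zero hu)

theorem metric_mfderiv (hg : IsInducedMetric g ι B) (hφ : ContMDiff (𝓡 n) (𝓡 m) 2 φ) (x : M)
    (u v : TangentSpace (𝓡 n) x) :
    g (φ x) (mfderiv (𝓡 n) (𝓡 m) φ x u) (mfderiv (𝓡 n) (𝓡 m) φ x v) =
      B (mfderiv (𝓡 n) 𝓘(ℝ, V) (ι ∘ φ) x u) (mfderiv (𝓡 n) 𝓘(ℝ, V) (ι ∘ φ) x v) := by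
  rw [hg.metric_eq, hg.mfderiv_comp_apply hφ, hg.mfderiv_comp_apply hφ]

theorem bilin_mfderiv_comp (hg : IsInducedMetric g ι B) (hφ : ContMDiff (𝓡 n) (𝓡 m) 2 φ) (x : M)
    (u : TangentSpace (𝓡 n) x) (ξ : TangentSpace (𝓡 m) (φ x)) :
    B (mfderiv (𝓡 n) 𝓘(ℝ, V) (ι ∘ φ) x u) (mfderiv (𝓡 m) 𝓘(ℝ, V) ι (φ x) ξ) =
      g (φ x) ξ (mfderiv (𝓡 n) (𝓡 m) φ x u) := by
  rw [hg.metric_eq, hg.mfderiv_comp_apply hφ]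
  exact hg.bilin_symm _ _

theorem gramMatrix_eq (hg : IsInducedMetric g ι B) (hφ : ContMDiff (𝓡 n) (𝓡 m) 2 φ) (x : M) :
    gramMatrix g φ x = flatGram B (coordRep (ι ∘ φ) x) (extChartAt (𝓡 n) x x) := by
  ext i j
  rw [gramMatrix, flatGram, Matrix.of_apply, Matrix.of_apply,
    fderiv_coordRep_self ((hg.contMDiff_comp hφ).mdifferentiable (by simp) x)]
  exact hg.metric_mfderiv hφ x (coordVec x i) (coordVec x j)

variable [IsManifold (𝓡 m) ∞ Q]

theorem meanCurvatureVector_pairing_eq (hg : IsInducedMetric g ι B)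
    (hφ : IsImmersionOfClass (𝓡 m) n 2 φ) {x : M} {ν : TangentSpace (𝓡 m) (φ x)}
    (hν : IsNormal (n := n) g φ x ν) :
    g (φ x) (meanCurvatureVector (n := n) g φ x) ν =
      (1 / (n : ℝ)) * flatTraceHessian B (coordRep (ι ∘ φ) x) (extChartAt (𝓡 n) x x)
        (mfderiv (𝓡 m) 𝓘(ℝ, V) ι (φ x) ν) := by
  rw [meanCurvatureVector_pairing (fun a b => hg.symm _ a b) (hg.isAnisotropicAt hφ x) hν,
    hg.gramMatrix_eq hφ.1]
  simp only [hg.metric_covariantHessian hφ.1]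
  rfl

/-- Replaces the chart preferred at `x` by one chart for all nearby points. The transition map `τ`
is `C²` because `M` is, and `dι ν` is orthogonal to the image of `d(ι ∘ φ)`, as
`flatTraceHessian_comp` requires. -/
theorem meanCurvatureVector_pairing_chart [IsManifold (𝓡 n) 2 M] (hg : IsInducedMetric g ι B)
    (hφ : IsImmersionOfClass (𝓡 m) n 2 φ) {p x : M} (hx : x ∈ (extChartAt (𝓡 n) p).source)
    {ν : TangentSpace (𝓡 m) (φ x)} (hν : IsNormal (n := n) g φ x ν) :
    g (φ x) (meanCurvatureVector (n := n) g φ x) ν =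
      (1 / (n : ℝ)) * flatTraceHessian B (coordRep (ι ∘ φ) p) (extChartAt (𝓡 n) p x)
        (mfderiv (𝓡 m) 𝓘(ℝ, V) ι (φ x) ν) := by
  have : IsManifold (𝓡 n) 1 M := IsManifold.of_le (n := 2) (by norm_num)
  rw [hg.meanCurvatureVector_pairing_eq hφ hν]
  have hsm := hg.contMDiff_comp hφ.1
  have hinv := (extChartAt (𝓡 n) x).left_inv (mem_extChartAt_source (I := 𝓡 n) x)
  set τ := extChartAt (𝓡 n) p ∘ (extChartAt (𝓡 n) x).symm with hτdef
  have hτx : τ (extChartAt (𝓡 n) x x) = extChartAt (𝓡 n) p x := by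
    rw [hτdef, Function.comp_apply, hinv]
  have hsource := (isOpen_extChartAt_source (I := 𝓡 n) p).mem_nhds hx
  have hsource' : (extChartAt (𝓡 n) p).source ∈
      𝓝 ((extChartAt (𝓡 n) x).symm (extChartAt (𝓡 n) x x)) := by rwa [hinv]
  have hev : coordRep (ι ∘ φ) x =ᶠ[𝓝 (extChartAt (𝓡 n) x x)] coordRep (ι ∘ φ) p ∘ τ := by
    filter_upwards [(continuousAt_extChartAt_symm (I := 𝓡 n) x).preimage_mem_nhds hsource']
      with y hy
    exact congrArg (ι ∘ φ) ((extChartAt (𝓡 n) p).left_inv hy).symm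
  have hτ : ContDiffAt ℝ 2 τ (extChartAt (𝓡 n) x x) := by
    rw [← contMDiffAt_iff_contDiffAt]
    refine ContMDiffAt.comp (I' := 𝓡 n) _ ?_ ((contMDiffOn_extChartAt_symm x).contMDiffAt
      ((isOpen_extChartAt_target x).mem_nhds (mem_extChartAt_target x)))
    exact contMDiffOn_extChartAt.contMDiffAt (by simpa using hsource')
  have hy := (extChartAt (𝓡 n) p).map_source hx
  refine congrArg ((1 / (n : ℝ)) * ·) ((flatTraceHessian_congr B hev _).trans
    ((flatTraceHessian_comp B ?_ hτ ?_ ?_).trans (by rw [hτx])))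
  · rw [hτx]
    exact contDiffAt_coordRep hsm hy
  · rw [← hev.fderiv_eq, fderiv_coordRep_self (hsm.mdifferentiable (by simp) x)]
    refine (injective_iff_map_eq_zero _).2 fun u hu => ?_
    have h1 := hg.bilin_mfderiv_comp hφ.1 x u (mfderiv (𝓡 n) (𝓡 m) φ x u)
    refine hg.isAnisotropicAt hφ x u (h1.symm.trans ?_)
    have h2 : ∀ a b : V, a = 0 → B a b = 0 := by rintro _ b rfl; simp
    exact h2 _ _ hu
  · intro v
    rw [hτx, fderiv_coordRep (hsm.mdifferentiable (by simp)) hy]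
    -- The derivative is based at the inverse chart's value, equal to `x` only through `left_inv`;
    -- generalizing the base point allows the substitution.
    have h2 : ∀ (x' : M) (_ : x' = x) (w : EuclideanSpace ℝ (Fin n)),
        B (mfderiv (𝓡 n) 𝓘(ℝ, V) (ι ∘ φ) x' w) (mfderiv (𝓡 m) 𝓘(ℝ, V) ι (φ x) ν) = 0 := by
      rintro _ rfl w
      exact (hg.bilin_mfderiv_comp hφ.1 _ w ν).trans (hν w)
    exact h2 _ ((extChartAt (𝓡 n) p).left_inv hx) _

theorem continuousOn_meanCurvature [IsManifold (𝓡 n) 2 M] (hg : IsInducedMetric g ι B)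
    (hφ : IsImmersionOfClass (𝓡 m) n 2 φ) {U : Set M} (hU : IsOpen U)
    {ν : (x : M) → TangentSpace (𝓡 m) (φ x)} (hν : IsUnitNormalFieldOn g n φ U ν) :
    ContinuousOn (meanCurvature g n φ ν) U := by
  intro x hx
  apply ContinuousAt.continuousWithinAt
  have hev : meanCurvature g n φ ν =ᶠ[𝓝 x] fun z => (1 / (n : ℝ)) *
      flatTraceHessian B (coordRep (ι ∘ φ) x) (extChartAt (𝓡 n) x z)
        (mfderiv (𝓡 m) 𝓘(ℝ, V) ι (φ z) (ν z)) := by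
    filter_upwards [hU.mem_nhds hx, extChartAt_source_mem_nhds (I := 𝓡 n) x] with z hz hz'
    exact hg.meanCurvatureVector_pairing_chart hφ hz' (hν.2 z hz).1
  refine ContinuousAt.congr ?_ hev.symm
  refine continuousAt_const.mul ?_
  have c1 := (continuousOn_mfderiv_apply (hg.smooth.of_le (WithTop.coe_le_coe.2 le_top))
    hν.1).continuousAt (hU.mem_nhds hx)
  have c2 := (continuousAt_extChartAt (I := 𝓡 n) x).prodMk c1
  have hsm := hg.contMDiff_comp hφ.1
  refine ContinuousAt.comp (f := fun z => ((extChartAt (𝓡 n) x z,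
    (mfderiv (𝓡 m) 𝓘(ℝ, V) ι (φ z) (ν z) : V)) : EuclideanSpace ℝ (Fin n) × V))
    (continuousAt_flatTraceHessian B (contDiffAt_coordRep hsm (mem_extChartAt_target x))
      (fun u hu => ?_) _) c2
  rw [fderiv_coordRep_self (hsm.mdifferentiable (by simp) x)] at hu
  apply hg.isAnisotropicAt hφ x
  exact (hg.metric_mfderiv hφ.1 x u u).trans hu

end IsInducedMetric

/-! ### Constructing continuous vector fields along a map. -/

section TangentBundle

variable {m : ℕ} {Q : Type*} [TopologicalSpace Q] [ChartedSpace (EuclideanSpace ℝ (Fin m)) Q]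
  [IsManifold (𝓡 m) 1 Q] {X : Type*} [TopologicalSpace X] {φ : X → Q} {U : Set X}

/-- Local trivializations of the tangent bundle are linear on fibres. -/
theorem continuousOn_smul_vectorField {ν : (x : X) → TangentSpace (𝓡 m) (φ x)} {s : X → ℝ}
    (hν : ContinuousOn (fun x => (⟨φ x, ν x⟩ : TangentBundle (𝓡 m) Q)) U)
    (hs : ContinuousOn s U) :
    ContinuousOn (fun x => (⟨φ x, s x • ν x⟩ : TangentBundle (𝓡 m) Q)) U := by
  intro x hx
  obtain ⟨h1, h2⟩ := (FiberBundle.continuousWithinAt_totalSpace _ _).1 (hν x hx)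
  refine (FiberBundle.continuousWithinAt_totalSpace _ _).2 ⟨h1, ?_⟩
  set e := trivializationAt (EuclideanSpace ℝ (Fin m)) (TangentSpace (𝓡 m) : Q → Type) (φ x)
  have hev : ∀ᶠ z in 𝓝[U] x, φ z ∈ e.baseSet :=
    h1.eventually (e.open_baseSet.mem_nhds (FiberBundle.mem_baseSet_trivializationAt _ _ _))
  refine ((hs x hx).smul h2).congr_of_eventuallyEq ?_ ?_
  · filter_upwards [hev] with z hz
    exact (e.linear ℝ hz).map_smul (s z) (ν z)
  · exact (e.linear ℝ (FiberBundle.mem_baseSet_trivializationAt _ _ _)).map_smul (s x) (ν x)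

/-- The tangent vector at `p` with constant components `v` in the preferred chart at `q`. -/
def constantVector (q p : Q) (v : EuclideanSpace ℝ (Fin m)) : TangentSpace (𝓡 m) p :=
  mfderiv 𝓘(ℝ, EuclideanSpace ℝ (Fin m)) (𝓡 m) (extChartAt (𝓡 m) q).symm (extChartAt (𝓡 m) q p) v

theorem mfderiv_constantVector {V : Type*} [NormedAddCommGroup V] [NormedSpace ℝ V] {ι : Q → V}
    (hι : MDifferentiable (𝓡 m) 𝓘(ℝ, V) ι) {q p : Q} (hp : p ∈ (extChartAt (𝓡 m) q).source)
    (v : EuclideanSpace ℝ (Fin m)) :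
    mfderiv (𝓡 m) 𝓘(ℝ, V) ι p (constantVector q p v) =
      fderiv ℝ (coordRep ι q) (extChartAt (𝓡 m) q p) v := by
  rw [fderiv_coordRep hι ((extChartAt (𝓡 m) q).map_source hp)]
  have h : ∀ (p' : Q) (_ : p' = p) (w : EuclideanSpace ℝ (Fin m)),
      (mfderiv (𝓡 m) 𝓘(ℝ, V) ι p w : V) = mfderiv (𝓡 m) 𝓘(ℝ, V) ι p' w := by
    rintro _ rfl _
    rfl
  exact h _ ((extChartAt (𝓡 m) q).left_inv hp) _

/-- The field is the image of the continuous pair `(chart (φ x), N x)` under the tangent map of the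
inverse chart. -/
theorem continuousOn_constantVector {q : Q} {N : X → EuclideanSpace ℝ (Fin m)}
    (hφ : ContinuousOn φ U) (hU : Set.MapsTo φ U (extChartAt (𝓡 m) q).source)
    (hN : ContinuousOn N U) :
    ContinuousOn (fun x => (⟨φ x, constantVector q (φ x) (N x)⟩ : TangentBundle (𝓡 m) Q)) U := by
  have ht := isOpen_extChartAt_target (I := 𝓡 m) q
  have h1 := (contMDiffOn_extChartAt_symm (I := 𝓡 m) (n := 1) q).continuousOn_tangentMapWithin
    le_rfl ht.uniqueMDiffOn
  have h2 : ContinuousOn (fun x => (extChartAt (𝓡 m) q (φ x), N x)) U :=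
    ((continuousOn_extChartAt q).comp hφ hU).prodMk hN
  have h3 := (tangentBundleModelSpaceHomeomorph
    𝓘(ℝ, EuclideanSpace ℝ (Fin m))).symm.continuous.comp_continuousOn h2
  refine (h1.comp h3 fun x hx => (extChartAt (𝓡 m) q).map_source (hU hx)).congr fun x hx => ?_
  have h4 : ∀ (p' : Q) (_ : p' = φ x) (w : EuclideanSpace ℝ (Fin m)),
      (⟨φ x, w⟩ : TangentBundle (𝓡 m) Q) = ⟨p', w⟩ := by
    rintro _ rfl _
    rfl
  refine (h4 _ ((extChartAt (𝓡 m) q).left_inv (hU hx)) _).trans ?_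
  have h5 := mfderivWithin_of_isOpen (I := 𝓘(ℝ, EuclideanSpace ℝ (Fin m))) (I' := 𝓡 m)
    (f := (extChartAt (𝓡 m) q).symm) ht ((extChartAt (𝓡 m) q).map_source (hU hx))
  refine congrArg (Bundle.TotalSpace.mk _) ?_
  exact (congrArg (fun L : EuclideanSpace ℝ (Fin m) →L[ℝ] EuclideanSpace ℝ (Fin m) => L (N x))
    h5).symm

end TangentBundle

/-! ### The normal line of a hypersurface and the choice of sign. -/

namespace IsInducedMetric

variable {n : ℕ} {Q : Type*} [TopologicalSpace Q]
  [ChartedSpace (EuclideanSpace ℝ (Fin (n + 1))) Q]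
  {V : Type*} [NormedAddCommGroup V] [NormedSpace ℝ V]
  {g : TensorField (𝓡 (n + 1)) Q} {ι : Q → V} {B : V →L[ℝ] V →L[ℝ] ℝ}
  {M : Type*} [TopologicalSpace M] [ChartedSpace (EuclideanSpace ℝ (Fin n)) M]
  {φ : M → Q}

theorem eq_zero_of_isNormal (hg : IsInducedMetric g ι B)
    (hφ : IsImmersionOfClass (𝓡 (n + 1)) n 2 φ) {x : M} {ν ξ : TangentSpace (𝓡 (n + 1)) (φ x)}
    (hν : IsNormal (n := n) g φ x ν) (hν0 : ν ≠ 0) (hξ : IsNormal (n := n) g φ x ξ)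
    (h : g (φ x) ξ ν = 0) : ξ = 0 := by
  have : FiniteDimensional ℝ (TangentSpace (𝓡 n) x) :=
    inferInstanceAs (FiniteDimensional ℝ (EuclideanSpace ℝ (Fin n)))
  have : FiniteDimensional ℝ (TangentSpace (𝓡 (n + 1)) (φ x)) :=
    inferInstanceAs (FiniteDimensional ℝ (EuclideanSpace ℝ (Fin (n + 1))))
  refine eq_zero_of_orthogonal_hyperplane (E := TangentSpace (𝓡 n) x) ?_ (g (φ x))
    (fun u => hg.eq_zero) (mfderiv (𝓡 n) (𝓡 (n + 1)) φ x).toLinearMap (hφ.2 x)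
    (hg.pos _ _ hν0).ne' hν hξ h
  exact (finrank_euclideanSpace_fin (𝕜 := ℝ) (n := n + 1)).trans
    (congrArg (· + 1) (finrank_euclideanSpace_fin (𝕜 := ℝ) (n := n)).symm)

/-- The normal space is a line, so `H = ⟨H, ν⟩ ν`. -/
theorem metric_meanCurvatureVector_self (hg : IsInducedMetric g ι B)
    (hφ : IsImmersionOfClass (𝓡 (n + 1)) n 2 φ) {x : M} {ν : TangentSpace (𝓡 (n + 1)) (φ x)}
    (hν : IsNormal (n := n) g φ x ν) (hν1 : g (φ x) ν ν = 1) :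
    g (φ x) (meanCurvatureVector (n := n) g φ x) (meanCurvatureVector (n := n) g φ x) =
      g (φ x) (meanCurvatureVector (n := n) g φ x) ν ^ 2 := by
  set H := meanCurvatureVector (n := n) g φ x
  have hH : IsNormal (n := n) g φ x H := isNormal_meanCurvatureVector (hg.isAnisotropicAt hφ x)
  have hν0 : ν ≠ 0 := by
    rintro rfl
    simp at hν1
  have h0 : H - g (φ x) H ν • ν = 0 := by
    refine hg.eq_zero_of_isNormal hφ hν hν0 (fun u => ?_) ?_
    · rw [map_sub (g (φ x)), LinearMap.sub_apply, map_smul, LinearMap.smul_apply, hH, hν]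
      simp
    · rw [map_sub (g (φ x)), LinearMap.sub_apply, map_smul, LinearMap.smul_apply, hν1]
      simp
  have h1 : H = g (φ x) H ν • ν := sub_eq_zero.1 h0
  conv_lhs => rw [h1]
  simp only [map_smul, LinearMap.smul_apply, hν1, smul_eq_mul]
  ring

theorem exists_normal_ne_zero (hg : IsInducedMetric g ι B)
    (hφ : IsImmersionOfClass (𝓡 (n + 1)) n 2 φ) (x : M) :
    ∃ ν : TangentSpace (𝓡 (n + 1)) (φ x), IsNormal (n := n) g φ x ν ∧ ν ≠ 0 := by
  let d : EuclideanSpace ℝ (Fin n) →ₗ[ℝ] EuclideanSpace ℝ (Fin (n + 1)) :=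
    (mfderiv (𝓡 n) (𝓡 (n + 1)) φ x).toLinearMap
  have hd : ¬ Function.Surjective d := by
    intro h
    have := LinearMap.finrank_le_finrank_of_surjective h
    simp at this
  obtain ⟨ξ, hξ⟩ := not_forall.1 hd
  obtain ⟨η, hη, u, hu⟩ := exists_normal_decomposition (hg.isAnisotropicAt hφ x) ξ
  refine ⟨η, hη, ?_⟩
  rintro rfl
  exact hξ ⟨u, (hu.trans (add_zero _)).symm⟩

/-- The sign `⟨H, ν₀⟩ / k` is itself a continuous function, so `U` need not be connected. -/
theorem exists_unitNormalField_meanCurvature_eq [IsManifold (𝓡 (n + 1)) ∞ Q]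
    [IsManifold (𝓡 n) 2 M] (hg : IsInducedMetric g ι B)
    (hφ : IsImmersionOfClass (𝓡 (n + 1)) n 2 φ) {U : Set M} (hU : IsOpen U)
    {ν₀ : (x : M) → TangentSpace (𝓡 (n + 1)) (φ x)} (hν₀ : IsUnitNormalFieldOn g n φ U ν₀) {k : ℝ}
    (hk : ∀ x ∈ U, g (φ x) (meanCurvatureVector (n := n) g φ x)
      (meanCurvatureVector (n := n) g φ x) = k ^ 2) :
    ∃ ν : (x : M) → TangentSpace (𝓡 (n + 1)) (φ x), IsUnitNormalFieldOn g n φ U ν ∧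
      ∀ x ∈ U, meanCurvature g n φ ν x = k := by
  have hsq : ∀ x ∈ U, meanCurvature g n φ ν₀ x ^ 2 = k ^ 2 := fun x hx =>
    (hg.metric_meanCurvatureVector_self hφ (hν₀.2 x hx).1 (hν₀.2 x hx).2).symm.trans (hk x hx)
  -- For `k = 0` the quotient is useless, but `⟨H, ν₀⟩ = 0` already.
  rcases eq_or_ne k 0 with rfl | hk0
  · exact ⟨ν₀, hν₀, fun x hx => by simpa using hsq x hx⟩
  refine ⟨fun x => (meanCurvature g n φ ν₀ x / k) • ν₀ x, ⟨?_, fun x hx => ⟨fun u => ?_, ?_⟩⟩,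
    fun x hx => ?_⟩
  · exact continuousOn_smul_vectorField hν₀.1 ((hg.continuousOn_meanCurvature hφ hU hν₀).div_const k)
  · rw [map_smul, LinearMap.smul_apply, (hν₀.2 x hx).1 u, smul_zero]
  · simp only [map_smul, LinearMap.smul_apply, (hν₀.2 x hx).2, smul_eq_mul, mul_one]
    rw [← sq, div_pow, hsq x hx, div_self (pow_ne_zero 2 hk0)]
  · have h1 : meanCurvature g n φ (fun x => (meanCurvature g n φ ν₀ x / k) • ν₀ x) x =
        meanCurvature g n φ ν₀ x / k * meanCurvature g n φ ν₀ x := by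
      simp only [meanCurvature, map_smul, smul_eq_mul]
    rw [h1, div_mul_eq_mul_div, ← sq, hsq x hx, sq, mul_div_assoc, div_self hk0, mul_one]

end IsInducedMetric

/-! ### Existence of local unit normal fields. -/

section PairingMap

variable {E F V : Type*} [NormedAddCommGroup E] [NormedSpace ℝ E]
  [NormedAddCommGroup F] [NormedSpace ℝ F] [NormedAddCommGroup V] [NormedSpace ℝ V]

/-- The map sending `v` to the pair of the form `a v ∘ b` and the number `a v c`. -/
def pairingMap (a : E →L[ℝ] V →L[ℝ] ℝ) (b : F →L[ℝ] V) (c : V) : E →L[ℝ] (F →L[ℝ] ℝ) × ℝ :=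
  (ContinuousLinearMap.inl ℝ (F →L[ℝ] ℝ) ℝ).comp
      (((ContinuousLinearMap.compL ℝ F V ℝ).flip b).comp a) +
    (ContinuousLinearMap.inr ℝ (F →L[ℝ] ℝ) ℝ).comp ((ContinuousLinearMap.apply ℝ ℝ c).comp a)

theorem pairingMap_fst (a : E →L[ℝ] V →L[ℝ] ℝ) (b : F →L[ℝ] V) (c : V) (v : E) (w : F) :
    (pairingMap a b c v).1 w = a v (b w) := by
  simp [pairingMap]

theorem pairingMap_snd (a : E →L[ℝ] V →L[ℝ] ℝ) (b : F →L[ℝ] V) (c : V) (v : E) :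
    (pairingMap a b c v).2 = a v c := by
  simp [pairingMap]

theorem continuousAt_pairingMap {X : Type*} [TopologicalSpace X] {x : X}
    {a : X → E →L[ℝ] V →L[ℝ] ℝ} {b : X → F →L[ℝ] V} {c : X → V} (ha : ContinuousAt a x)
    (hb : ContinuousAt b x) (hc : ContinuousAt c x) :
    ContinuousAt (fun x => pairingMap (a x) (b x) (c x)) x := by
  have add {G : Type _} [NormedAddCommGroup G] [NormedSpace ℝ G] {p q : X → E →L[ℝ] G}
      (hp : ContinuousAt p x) (hq : ContinuousAt q x) : ContinuousAt (fun x => p x + q x) x :=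
    hp.add hq
  exact add (continuousAt_const.clm_comp
      (((ContinuousLinearMap.continuous _).continuousAt.comp hb).clm_comp ha))
    (continuousAt_const.clm_comp
      (((ContinuousLinearMap.continuous _).continuousAt.comp hc).clm_comp ha))

end PairingMap

namespace IsInducedMetric

variable {n : ℕ} {Q : Type*} [TopologicalSpace Q]
  [ChartedSpace (EuclideanSpace ℝ (Fin (n + 1))) Q]
  {V : Type*} [NormedAddCommGroup V] [NormedSpace ℝ V]
  {g : TensorField (𝓡 (n + 1)) Q} {ι : Q → V} {B : V →L[ℝ] V →L[ℝ] ℝ}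
  {M : Type*} [TopologicalSpace M] [ChartedSpace (EuclideanSpace ℝ (Fin n)) M]
  {φ : M → Q}

/-- A normal direction solves a linear system: zero pairing with all tangent vectors, pairing `1`
with a transversal field. At `x₀` the system is injective, hence invertible by dimension.
Invertibility is open and inversion continuous, so the solution extends continuously to a
neighbourhood; then it is normalized. -/
theorem exists_local_unitNormalField [IsManifold (𝓡 (n + 1)) ∞ Q]
    [IsManifold (𝓡 n) 2 M] (hg : IsInducedMetric g ι B)
    (hφ : IsImmersionOfClass (𝓡 (n + 1)) n 2 φ) (x₀ : M) :
    ∃ U : Set M, IsOpen U ∧ x₀ ∈ U ∧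
      ∃ ν : (x : M) → TangentSpace (𝓡 (n + 1)) (φ x), IsUnitNormalFieldOn g n φ U ν := by
  have : IsManifold (𝓡 n) 1 M := IsManifold.of_le (n := 2) (by norm_num)
  have hsm := hg.contMDiff_comp hφ.1
  have hsmd := hsm.mdifferentiable (n := 2) (by simp)
  obtain ⟨Z, hZ, hZ0⟩ := hg.exists_normal_ne_zero hφ x₀
  let Z' : EuclideanSpace ℝ (Fin (n + 1)) := Z
  let F := coordRep (k := n + 1) ι (φ x₀)
  let Φ := coordRep (k := n) (ι ∘ φ) x₀
  let y : M → EuclideanSpace ℝ (Fin (n + 1)) := fun x => extChartAt (𝓡 (n + 1)) (φ x₀) (φ x)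
  let z : M → EuclideanSpace ℝ (Fin n) := fun x => extChartAt (𝓡 n) x₀ x
  let W : Set M := φ ⁻¹' (extChartAt (𝓡 (n + 1)) (φ x₀)).source ∩ (extChartAt (𝓡 n) x₀).source
  have hW : IsOpen W := ((isOpen_extChartAt_source _).preimage hφ.1.continuous).inter
    (isOpen_extChartAt_source _)
  have hx₀ : x₀ ∈ W := ⟨mem_extChartAt_source _, mem_extChartAt_source _⟩
  have cy : ∀ x ∈ W, ContinuousAt y x := fun x hx =>
    (continuousAt_extChartAt' hx.1).comp hφ.1.continuous.continuousAt
  have cz : ∀ x ∈ W, ContinuousAt z x := fun x hx => continuousAt_extChartAt' hx.2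
  have cF : ∀ x ∈ W, ContinuousAt (fun x => fderiv ℝ F (y x)) x := fun x hx => by
    refine ContinuousAt.comp (g := fderiv ℝ F) ?_ (cy x hx)
    exact ((contDiffAt_coordRep (hg.smooth.of_le (m := 1) (WithTop.coe_le_coe.2 le_top))
      ((extChartAt _ _).map_source hx.1)).fderiv_right (m := 0) (by norm_num)).continuousAt
  have cΦ : ∀ x ∈ W, ContinuousAt (fun x => fderiv ℝ Φ (z x)) x := fun x hx => by
    refine ContinuousAt.comp (g := fderiv ℝ Φ) ?_ (cz x hx)
    exact ((contDiffAt_coordRep hsm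
      ((extChartAt _ _).map_source hx.2)).fderiv_right (m := 1) (by norm_num)).continuousAt
  let L := EuclideanSpace ℝ (Fin n) →L[ℝ] ℝ
  let A : M → EuclideanSpace ℝ (Fin (n + 1)) →L[ℝ] (V →L[ℝ] ℝ) := fun x =>
    B.comp (fderiv ℝ F (y x))
  -- The transversal field has the constant components of the normal vector `Z` at `x₀`, in the
  -- chart at `φ x₀`.
  let T : M → EuclideanSpace ℝ (Fin (n + 1)) →L[ℝ] L × ℝ := fun x =>
    pairingMap (A x) (fderiv ℝ Φ (z x)) (fderiv ℝ F (y x) Z')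
  have T1 : ∀ x N v, (T x N).1 v = B (fderiv ℝ F (y x) N) (fderiv ℝ Φ (z x) v) :=
    fun x N v => pairingMap_fst _ _ _ N v
  have T2 : ∀ x N, (T x N).2 = B (fderiv ℝ F (y x) N) (fderiv ℝ F (y x) Z') :=
    fun x N => pairingMap_snd _ _ _ N
  have cA : ∀ x ∈ W, ContinuousAt A x := fun x hx => continuousAt_const.clm_comp (cF x hx)
  have cT : ∀ x ∈ W, ContinuousAt T x := fun x hx =>
    continuousAt_pairingMap (cA x hx) (cΦ x hx) ((cF x hx).clm_apply continuousAt_const)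
  have hι : ∀ x ∈ W, ∀ N, mfderiv (𝓡 (n + 1)) 𝓘(ℝ, V) ι (φ x) (constantVector (φ x₀) (φ x) N) =
      fderiv ℝ F (y x) N := fun x hx N => mfderiv_constantVector hg.mdifferentiable hx.1 N
  have hmetric : ∀ x ∈ W, ∀ N N', g (φ x) (constantVector (φ x₀) (φ x) N)
      (constantVector (φ x₀) (φ x) N') = B (fderiv ℝ F (y x) N) (fderiv ℝ F (y x) N') := by
    intro x hx N N'
    rw [hg.metric_eq, hι x hx, hι x hx]
  have hpair : ∀ x ∈ W, ∀ (N) (u : TangentSpace (𝓡 n) x),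
      g (φ x) (constantVector (φ x₀) (φ x) N) (mfderiv (𝓡 n) (𝓡 (n + 1)) φ x u) =
        (T x N).1 (mfderiv (𝓡 n) 𝓘(ℝ, EuclideanSpace ℝ (Fin n)) (extChartAt (𝓡 n) x₀) x u) := by
    intro x hx N u
    rw [hg.metric_eq, hι x hx, ← hg.mfderiv_comp_apply hφ.1,
      mfderiv_eq_fderiv_coordRep hsmd hx.2]
    exact (T1 x N _).symm
  have hinj : Function.Injective (T x₀) := by
    refine (injective_iff_map_eq_zero _).2 fun N hN => ?_
    have hF0 : fderiv ℝ F (y x₀) = mfderiv (𝓡 (n + 1)) 𝓘(ℝ, V) ι (φ x₀) :=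
      fderiv_coordRep_self (hg.mdifferentiable _)
    have hΦ0 : fderiv ℝ Φ (z x₀) = mfderiv (𝓡 n) 𝓘(ℝ, V) (ι ∘ φ) x₀ :=
      fderiv_coordRep_self (hsmd _)
    refine hg.eq_zero_of_isNormal hφ hZ hZ0 (ξ := N) (fun u => ?_) ?_
    · have h1 := T1 x₀ N u
      rw [hN, hΦ0, hF0] at h1
      refine (hg.bilin_mfderiv_comp hφ.1 x₀ u N).symm.trans ((hg.bilin_symm _ _).trans h1.symm)
    · have h2 := T2 x₀ N
      rw [hN, hF0] at h2
      exact (hg.metric_eq _ _ _).trans h2.symm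
  have hdim : Module.finrank ℝ (EuclideanSpace ℝ (Fin (n + 1))) = Module.finrank ℝ (L × ℝ) := by
    rw [Module.finrank_prod, ← (LinearMap.toContinuousLinearMap (𝕜 := ℝ)
      (E := EuclideanSpace ℝ (Fin n)) (F' := ℝ)).finrank_eq, Module.finrank_linearMap]
    simp
  have : FiniteDimensional ℝ L := inferInstance
  let e₀ : EuclideanSpace ℝ (Fin (n + 1)) ≃L[ℝ] L × ℝ :=
    (LinearEquiv.ofInjectiveOfFinrankEq (T x₀).toLinearMap hinj hdim).toContinuousLinearEquiv
  have he₀ : (e₀ : EuclideanSpace ℝ (Fin (n + 1)) →L[ℝ] L × ℝ) = T x₀ := by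
    ext1 N
    rfl
  have hnear : ∀ᶠ x in 𝓝 x₀, T x ∈ Set.range
      ((↑) : (EuclideanSpace ℝ (Fin (n + 1)) ≃L[ℝ] L × ℝ) → _ →L[ℝ] _) :=
    (cT x₀ hx₀).eventually (he₀ ▸ e₀.nhds)
  obtain ⟨U, hUsub, hU, hxU⟩ := mem_nhds_iff.1 (Filter.inter_mem hnear (hW.mem_nhds hx₀))
  -- `inverse` is the true inverse only on `U`, where `T x` is invertible.
  let N : M → EuclideanSpace ℝ (Fin (n + 1)) := fun x => (T x).inverse (0, 1)
  have hTN : ∀ x ∈ U, T x (N x) = (0, 1) := fun x hx => by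
    obtain ⟨e, he⟩ := (hUsub hx).1
    simp [N, ← he]
  have cN : ∀ x ∈ U, ContinuousAt N x := fun x hx => by
    obtain ⟨e, he⟩ := (hUsub hx).1
    have h1 : ContinuousAt (ContinuousLinearMap.inverse : _ → L × ℝ →L[ℝ] _) (T x) :=
      he ▸ (contDiffAt_map_inverse (n := 0) e).continuousAt
    exact (h1.comp (cT x (hUsub hx).2)).clm_apply continuousAt_const
  let r : M → ℝ := fun x => B (fderiv ℝ F (y x) (N x)) (fderiv ℝ F (y x) (N x))
  have hr : ∀ x ∈ U, 0 < r x := fun x hx => by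
    have hxW := (hUsub hx).2
    refine (hg.pos (φ x) (constantVector (φ x₀) (φ x) (N x)) fun h0 => ?_).trans_eq
      (hmetric x hxW _ _)
    -- The second component `1` rules out the zero vector.
    have h1 := T2 x (N x)
    rw [hTN x hx, ← hmetric x hxW, h0] at h1
    simp at h1
  have cr : ∀ x ∈ U, ContinuousAt r x := fun x hx =>
    (B.continuous.continuousAt.comp ((cF x (hUsub hx).2).clm_apply (cN x hx))).clm_apply
      ((cF x (hUsub hx).2).clm_apply (cN x hx))
  have hsmul : ∀ x (a : ℝ), constantVector (φ x₀) (φ x) (a • N x) =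
      a • constantVector (φ x₀) (φ x) (N x) := fun x a =>
    (mfderiv 𝓘(ℝ, EuclideanSpace ℝ (Fin (n + 1))) (𝓡 (n + 1))
      (extChartAt (𝓡 (n + 1)) (φ x₀)).symm (y x)).map_smul a (N x)
  refine ⟨U, hU, hxU, fun x => constantVector (φ x₀) (φ x) ((Real.sqrt (r x))⁻¹ • N x), ?_,
    fun x hx => ⟨fun u => ?_, ?_⟩⟩
  · refine continuousOn_constantVector hφ.1.continuous.continuousOn
      (fun x hx => (hUsub hx).2.1) fun x hx => ContinuousAt.continuousWithinAt ?_
    exact ((cr x hx).sqrt.inv₀ (Real.sqrt_ne_zero'.2 (hr x hx))).smul (cN x hx)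
  · beta_reduce
    rw [hsmul, map_smul, LinearMap.smul_apply, hpair x (hUsub hx).2, hTN x hx]
    exact smul_zero _
  · beta_reduce
    rw [hsmul]
    simp only [map_smul, LinearMap.smul_apply, smul_eq_mul]
    rw [hmetric x (hUsub hx).2, ← mul_assoc, ← mul_inv, Real.mul_self_sqrt (hr x hx).le,
      inv_mul_cancel₀ (hr x hx).ne']

end IsInducedMetric

/-! ### The three space forms as induced metrics. -/

theorem isInducedMetric_euclidean (m : ℕ) :
    IsInducedMetric (Q := EuclideanSpace ℝ (Fin m)) (fun _ => innerₗ (EuclideanSpace ℝ (Fin m)))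
      id (innerSL ℝ) where
  smooth := contMDiff_id
  bilin_symm a b := real_inner_comm b a
  metric_eq p u v := by
    rw [mfderiv_id]
    rfl
  pos p u hu := by
    let u' : EuclideanSpace ℝ (Fin m) := u
    have hu' : u' ≠ 0 := hu
    exact real_inner_self_pos.2 hu'

theorem isInducedMetric_sphere (m : ℕ) :
    IsInducedMetric (SpaceForm.sphereMetric m) Subtype.val
      (innerSL ℝ : EuclideanSpace ℝ (Fin (m + 1)) →L[ℝ] _) := by
  have : Fact (Module.finrank ℝ (EuclideanSpace ℝ (Fin (m + 1))) = m + 1) := ⟨by simp⟩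
  refine ⟨contMDiff_coe_sphere, fun a b => real_inner_comm b a, fun p u v => rfl, fun p u hu => ?_⟩
  let a : EuclideanSpace ℝ (Fin (m + 1)) := mvfderiv (𝓡 m)
    (Subtype.val : Metric.sphere (0 : EuclideanSpace ℝ (Fin (m + 1))) 1 → _) p u
  have ha : a ≠ 0 := fun h0 => hu ((map_eq_zero_iff _ (injective_mvfderiv_subtypeVal_sphere p)).1 h0)
  exact real_inner_self_pos.2 ha

namespace Hyperbolic

variable {m : ℕ}

theorem contDiff_lift {r : ℕ∞ω} : ContDiff ℝ r (lift (m := m)) := by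
  rw [contDiff_euclidean]
  intro j
  refine Fin.lastCases ?_ (fun i => ?_) j
  · simp only [lift_last]
    exact ContDiff.sqrt (by fun_prop) fun y => (one_add_pos y).ne'
  · simp only [lift_castSucc]
    fun_prop

theorem coordRep_incl (x : Hyperbolic m) : coordRep incl x = lift := rfl

theorem contMDiff_incl {r : ℕ∞ω} :
    ContMDiff (𝓡 m) 𝓘(ℝ, EuclideanSpace ℝ (Fin (m + 1))) r (incl (m := m)) := by
  rw [contMDiff_iff]
  exact ⟨continuous_subtype_val, fun x y => (contDiff_lift (r := r)).contDiffOn⟩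

theorem fderiv_lift_castSucc (y u : EuclideanSpace ℝ (Fin m)) (i : Fin m) :
    fderiv ℝ lift y u i.castSucc = u i := by
  have h := ((EuclideanSpace.proj (𝕜 := ℝ) i.castSucc).hasFDerivAt.comp y
    ((contDiff_lift (r := 1)).differentiable (by simp) y).hasFDerivAt).fderiv
  have h2 : (EuclideanSpace.proj (𝕜 := ℝ) (i.castSucc : Fin (m + 1)) : _ → ℝ) ∘ lift =
      (EuclideanSpace.proj (𝕜 := ℝ) i : EuclideanSpace ℝ (Fin m) → ℝ) := by
    ext y
    exact lift_castSucc y i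
  rw [h2, ContinuousLinearMap.fderiv] at h
  exact (congrArg (fun L => L u) h).symm

/-- Differentiate the square of the last coordinate, which is `1 + |y|²`. -/
theorem fderiv_lift_last_mul (y u : EuclideanSpace ℝ (Fin m)) :
    fderiv ℝ lift y u (Fin.last m) * Real.sqrt (1 + ∑ i, y i ^ 2) = ∑ i, y i * u i := by
  have h := ((EuclideanSpace.proj (𝕜 := ℝ) (Fin.last m)).hasFDerivAt.comp y
    ((contDiff_lift (r := 1)).differentiable (by simp) y).hasFDerivAt)
  have h1 := h.mul h
  have h2 : HasFDerivAt (fun y : EuclideanSpace ℝ (Fin m) => 1 + ∑ i, y i * y i)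
      (∑ i, (y i • EuclideanSpace.proj (𝕜 := ℝ) i + y i • EuclideanSpace.proj (𝕜 := ℝ) i)) y :=
    (HasFDerivAt.fun_sum fun i _ =>
      (EuclideanSpace.proj (𝕜 := ℝ) i).hasFDerivAt.mul
        (EuclideanSpace.proj (𝕜 := ℝ) i).hasFDerivAt).const_add 1
  have h3 : ((EuclideanSpace.proj (𝕜 := ℝ) (Fin.last m) : _ → ℝ) ∘ lift) *
      ((EuclideanSpace.proj (𝕜 := ℝ) (Fin.last m) : _ → ℝ) ∘ lift) =
      fun y : EuclideanSpace ℝ (Fin m) => 1 + ∑ i, y i * y i := by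
    ext y
    simp only [Pi.mul_apply, Function.comp_apply, PiLp.proj_apply, lift_last]
    rw [Real.mul_self_sqrt (one_add_pos y).le]
    simp [sq]
  rw [h3] at h1
  have h4 := congrArg (fun L => L u) (h1.unique h2)
  simp only [Function.comp_apply, add_apply, smul_apply, sum_apply, smul_eq_mul,
    ContinuousLinearMap.comp_apply, PiLp.proj_apply, lift_last,
    Finset.sum_add_distrib] at h4
  linarith

/-- With `t` the last component, Cauchy–Schwarz gives `t² (1 + |y|²) = ⟨y, u⟩² ≤ |y|² |u|²`, hence
`t² < |u|²`. -/
theorem lorentzForm_fderiv_lift_pos (y u : EuclideanSpace ℝ (Fin m)) (hu : u ≠ 0) :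
    0 < lorentzForm m (fderiv ℝ lift y u) (fderiv ℝ lift y u) := by
  simp only [lorentzForm, LinearMap.mk₂_apply, fderiv_lift_castSucc]
  have h1 := fderiv_lift_last_mul y u
  set t := fderiv ℝ lift y u (Fin.last m)
  have hs : Real.sqrt (1 + ∑ i, y i ^ 2) ^ 2 = 1 + ∑ i, y i ^ 2 := Real.sq_sqrt (one_add_pos y).le
  have hcs := Finset.sum_mul_sq_le_sq_mul_sq Finset.univ (fun i => y i) (fun i => u i)
  rw [← h1, mul_pow, hs] at hcs
  have hpos : 0 < ∑ i, u i * u i := by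
    have := real_inner_self_pos.2 hu
    rwa [PiLp.inner_apply] at this
  have hy := one_add_pos y
  have e : ∑ i, u i ^ 2 = ∑ i, u i * u i := by simp [sq]
  rw [e] at hcs
  nlinarith

end Hyperbolic

theorem isInducedMetric_hyperbolic (m : ℕ) :
    IsInducedMetric (Hyperbolic.metric m) Hyperbolic.incl
      (lorentzForm m).toContinuousBilinearMap where
  smooth := Hyperbolic.contMDiff_incl
  bilin_symm a b := by
    simp only [LinearMap.toContinuousBilinearMap_apply, lorentzForm, LinearMap.mk₂_apply, mul_comm]
  metric_eq p u v := rfl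
  pos p u hu := by
    have h := fderiv_coordRep_self ((Hyperbolic.contMDiff_incl (m := m) (r := 1)).mdifferentiable
      (by simp) p)
    refine (Hyperbolic.lorentzForm_fderiv_lift_pos (extChartAt (𝓡 m) p p) u hu).trans_eq ?_
    rw [← Hyperbolic.coordRep_incl p, h]
    rfl

theorem SpaceForm.exists_isInducedMetric (m : ℕ) (c : SignType) :
    ∃ (N : ℕ) (ι : SpaceForm m c → EuclideanSpace ℝ (Fin N))
      (B : EuclideanSpace ℝ (Fin N) →L[ℝ] EuclideanSpace ℝ (Fin N) →L[ℝ] ℝ),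
      IsInducedMetric (SpaceForm.metric m c) ι B :=
  match c with
  | .zero => ⟨_, _, _, isInducedMetric_euclidean m⟩
  | .neg => ⟨_, _, _, isInducedMetric_hyperbolic m⟩
  | .pos => ⟨_, _, _, isInducedMetric_sphere m⟩

/-! ### The warped metric and its Christoffel symbols. -/

section Warped

variable {m : ℕ} {Q : Type*} [TopologicalSpace Q] [ChartedSpace (EuclideanSpace ℝ (Fin m)) Q]
  {J : TopologicalSpace.Opens ℝ}

/-- The tangent vector of `Q × J` with components `v` and `s`. -/
def tangentPair (p : Q × J) (v : TangentSpace (𝓡 m) p.1) (s : ℝ) :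
    TangentSpace ((𝓡 m).prod 𝓘(ℝ, ℝ)) p :=
  (show EuclideanSpace ℝ (Fin m) × ℝ from (v, s))

theorem exists_eq_tangentPair (p : Q × J) (a : TangentSpace ((𝓡 m).prod 𝓘(ℝ, ℝ)) p) :
    ∃ v s, a = tangentPair p v s := ⟨_, _, rfl⟩

theorem tangentPair_add (p : Q × J) (v v' : TangentSpace (𝓡 m) p.1) (s s' : ℝ) :
    tangentPair p v s + tangentPair p v' s' = tangentPair p (v + v') (s + s') := rfl

theorem smul_tangentPair (p : Q × J) (v : TangentSpace (𝓡 m) p.1) (s c : ℝ) :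
    c • tangentPair p v s = tangentPair p (c • v) (c * s) := rfl

theorem sum_tangentPair {α : Type*} (A : Finset α) (p : Q × J) (v : α → TangentSpace (𝓡 m) p.1)
    (s : α → ℝ) : ∑ i ∈ A, tangentPair p (v i) (s i) = tangentPair p (∑ i ∈ A, v i) (∑ i ∈ A, s i) := by
  classical
  induction A using Finset.induction_on with
  | empty => simp; rfl
  | insert i A hi ih => rw [Finset.sum_insert hi, Finset.sum_insert hi, Finset.sum_insert hi, ih,
      tangentPair_add]

theorem val_extChartAt_symm (T : J) {s : ℝ} (hs : s ∈ (extChartAt 𝓘(ℝ, ℝ) T).target) :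
    (((extChartAt 𝓘(ℝ, ℝ) T).symm s : J) : ℝ) = s :=
  (extChartAt 𝓘(ℝ, ℝ) T).right_inv hs

theorem extChartAt_self_eq (T : J) : extChartAt 𝓘(ℝ, ℝ) T T = (T : ℝ) := rfl

theorem mdifferentiable_val : MDifferentiable 𝓘(ℝ, ℝ) 𝓘(ℝ, ℝ) (Subtype.val : J → ℝ) :=
  (contMDiff_subtype_val (n := 1)).mdifferentiable (by simp)

theorem mfderiv_val (T : J) (s : TangentSpace 𝓘(ℝ, ℝ) T) :
    mfderiv 𝓘(ℝ, ℝ) 𝓘(ℝ, ℝ) (Subtype.val : J → ℝ) T s = s := by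
  have h := (mdifferentiable_val T).mfderiv
  rw [modelWithCornersSelf_coe, Set.range_id, fderivWithin_univ] at h
  have hev : writtenInExtChartAt 𝓘(ℝ, ℝ) 𝓘(ℝ, ℝ) T (Subtype.val : J → ℝ) =ᶠ[𝓝 (T : ℝ)] id := by
    filter_upwards [(isOpen_extChartAt_target (I := 𝓘(ℝ, ℝ)) T).mem_nhds (mem_extChartAt_target T)]
      with s hs using val_extChartAt_symm T hs
  have h2 : fderiv ℝ (writtenInExtChartAt 𝓘(ℝ, ℝ) 𝓘(ℝ, ℝ) T (Subtype.val : J → ℝ))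
      (extChartAt 𝓘(ℝ, ℝ) T T) = ContinuousLinearMap.id ℝ ℝ := by
    rw [extChartAt_self_eq, hev.fderiv_eq, fderiv_id]
  exact (congrArg (fun L : ℝ →L[ℝ] ℝ => L s) (h.trans h2))

theorem mfderiv_time (p : Q × J) (v : TangentSpace (𝓡 m) p.1) (s : ℝ) :
    mfderiv ((𝓡 m).prod 𝓘(ℝ, ℝ)) 𝓘(ℝ, ℝ) (fun q : Q × J => (q.2 : ℝ)) p (tangentPair p v s) = s := by
  have h := mfderiv_comp p (g := (Subtype.val : J → ℝ)) (f := (Prod.snd : Q × J → J))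
    (I := (𝓡 m).prod 𝓘(ℝ, ℝ)) (mdifferentiable_val p.2) mdifferentiableAt_snd
  rw [mfderiv_snd] at h
  exact (congrArg (fun L : (EuclideanSpace ℝ (Fin m) × ℝ) →L[ℝ] ℝ => L (v, s)) h).trans
    (mfderiv_val p.2 s)

theorem warpedMetric_tangentPair (g : TensorField (𝓡 m) Q) (w : ℝ → ℝ) (p : Q × J)
    (u v : TangentSpace (𝓡 m) p.1) (a b : ℝ) :
    warpedMetric g J w p (tangentPair p u a) (tangentPair p v b) =
      w p.2 ^ 2 * g p.1 u v - a * b := by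
  have h1 : ∀ (v : TangentSpace (𝓡 m) p.1) (s : ℝ),
      mfderiv ((𝓡 m).prod 𝓘(ℝ, ℝ)) (𝓡 m) (Prod.fst : Q × J → Q) p (tangentPair p v s) = v := by
    intro v s
    rw [mfderiv_fst]
    rfl
  have h2 : warpedMetric g J w p (tangentPair p u a) (tangentPair p v b) =
      w p.2 ^ 2 * g p.1
        (mfderiv ((𝓡 m).prod 𝓘(ℝ, ℝ)) (𝓡 m) (Prod.fst : Q × J → Q) p (tangentPair p u a))
        (mfderiv ((𝓡 m).prod 𝓘(ℝ, ℝ)) (𝓡 m) (Prod.fst : Q × J → Q) p (tangentPair p v b)) -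
      LinearMap.mul ℝ ℝ
        (mfderiv ((𝓡 m).prod 𝓘(ℝ, ℝ)) 𝓘(ℝ, ℝ) (fun q : Q × J => (q.2 : ℝ)) p (tangentPair p u a))
        (mfderiv ((𝓡 m).prod 𝓘(ℝ, ℝ)) 𝓘(ℝ, ℝ) (fun q : Q × J => (q.2 : ℝ)) p (tangentPair p v b)) :=
    rfl
  rw [h2, h1, h1, mfderiv_time, mfderiv_time, LinearMap.mul_apply']

/-- The chart is a product whose time factor is the inclusion of `J`, so time components are
unchanged. -/
theorem metricInChart_warpedMetric [IsManifold (𝓡 m) 1 Q] (g : TensorField (𝓡 m) Q) (w : ℝ → ℝ)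
    (q : Q) (T : J) (u v : EuclideanSpace ℝ (Fin m)) (a b : ℝ) {y : EuclideanSpace ℝ (Fin m)}
    {s : ℝ} (hy : y ∈ (extChartAt (𝓡 m) q).target) (hs : s ∈ (extChartAt 𝓘(ℝ, ℝ) T).target) :
    metricInChart (warpedMetric g J w) (q, T) (u, a) (v, b) (y, s) =
      w s ^ 2 * metricInChart g q u v y - a * b := by
  have hsym : ((extChartAt ((𝓡 m).prod 𝓘(ℝ, ℝ)) (q, T)).symm :
      EuclideanSpace ℝ (Fin m) × ℝ → Q × J) =
      Prod.map (extChartAt (𝓡 m) q).symm (extChartAt 𝓘(ℝ, ℝ) T).symm := by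
    rw [extChartAt_prod]
    rfl
  have dT : MDifferentiableAt 𝓘(ℝ, ℝ) 𝓘(ℝ, ℝ) (extChartAt 𝓘(ℝ, ℝ) T).symm s :=
    ((contMDiffOn_extChartAt_symm (n := 1) T).contMDiffAt
      ((isOpen_extChartAt_target T).mem_nhds hs)).mdifferentiableAt (by simp)
  have hd : ∀ (v : EuclideanSpace ℝ (Fin m)) (b : ℝ),
      mfderiv 𝓘(ℝ, EuclideanSpace ℝ (Fin m) × ℝ) ((𝓡 m).prod 𝓘(ℝ, ℝ))
        (extChartAt ((𝓡 m).prod 𝓘(ℝ, ℝ)) (q, T)).symm (y, s) (v, b) =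
      tangentPair _ (mfderiv 𝓘(ℝ, EuclideanSpace ℝ (Fin m)) (𝓡 m)
        (extChartAt (𝓡 m) q).symm y v) b := by
    intro v b
    rw [modelWithCornersSelf_prod, ← chartedSpaceSelf_prod, hsym]
    have h1 := mfderiv_prodMap (p := (y, s)) (mdifferentiableAt_extChartAt_symm hy) dT
    have h2 : mfderiv 𝓘(ℝ, ℝ) 𝓘(ℝ, ℝ) (extChartAt 𝓘(ℝ, ℝ) T).symm s b = b := by
      have h3 : (Subtype.val : J → ℝ) ∘ (extChartAt 𝓘(ℝ, ℝ) T).symm =ᶠ[𝓝 s] id := by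
        filter_upwards [(isOpen_extChartAt_target (I := 𝓘(ℝ, ℝ)) T).mem_nhds hs]
          with s hs using val_extChartAt_symm T hs
      have h4 := mfderiv_comp s (mdifferentiable_val _) dT
      rw [h3.mfderiv_eq, mfderiv_id] at h4
      have h5 := congrArg (fun L : ℝ →L[ℝ] ℝ => L b) h4
      exact (h5.trans (mfderiv_val _ _)).symm
    exact (congrArg (fun L : EuclideanSpace ℝ (Fin m) × ℝ →L[ℝ] EuclideanSpace ℝ (Fin m) × ℝ =>
      L (v, b)) h1).trans (congrArg (Prod.mk _) h2)
  rw [metricInChart, hd, hd]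
  refine (warpedMetric_tangentPair g w _ _ _ a b).trans ?_
  rw [hsym]
  simp only [Prod.map_apply]
  rw [val_extChartAt_symm T hs]
  rfl

end Warped

/-! ### Extrinsic geometry of a time slice. -/

theorem mfderiv_slice {m : ℕ} {Q : Type*} [TopologicalSpace Q]
    [ChartedSpace (EuclideanSpace ℝ (Fin m)) Q] {J : TopologicalSpace.Opens ℝ} {T : J} {n : ℕ}
    {M : Type*} [TopologicalSpace M] [ChartedSpace (EuclideanSpace ℝ (Fin n)) M] {φ : M → Q}
    (hφ : MDifferentiable (𝓡 n) (𝓡 m) φ) (x : M) (u : TangentSpace (𝓡 n) x) :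
    mfderiv (𝓡 n) ((𝓡 m).prod 𝓘(ℝ, ℝ)) (fun x => (φ x, T)) x u =
      tangentPair (φ x, T) (mfderiv (𝓡 n) (𝓡 m) φ x u) 0 := by
  rw [mfderiv_prodMk (hφ x) mdifferentiableAt_const, mfderiv_const]
  rfl

namespace IsInducedMetric

variable {m : ℕ} {Q : Type*} [TopologicalSpace Q] [ChartedSpace (EuclideanSpace ℝ (Fin m)) Q]
  [IsManifold (𝓡 m) ∞ Q] {V : Type*} [NormedAddCommGroup V] [NormedSpace ℝ V]
  {g : TensorField (𝓡 m) Q} {ι : Q → V} {B : V →L[ℝ] V →L[ℝ] ℝ}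
  {J : TopologicalSpace.Opens ℝ} {w : ℝ → ℝ}

theorem fderiv_metricInChart_warpedMetric (hg : IsInducedMetric g ι B) (q : Q) (T : J)
    (hw : DifferentiableAt ℝ w T) (u v z : EuclideanSpace ℝ (Fin m)) (a b c : ℝ) :
    fderiv ℝ (metricInChart (warpedMetric g J w) (q, T) (u, a) (v, b))
        (extChartAt ((𝓡 m).prod 𝓘(ℝ, ℝ)) (q, T) (q, T)) (z, c) =
      w T ^ 2 * fderiv ℝ (metricInChart g q u v) (extChartAt (𝓡 m) q q) z +
        2 * w T * deriv w T * c * metricInChart g q u v (extChartAt (𝓡 m) q q) := by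
  have hbase : extChartAt ((𝓡 m).prod 𝓘(ℝ, ℝ)) (q, T) (q, T) =
      (extChartAt (𝓡 m) q q, (T : ℝ)) := by
    rw [extChartAt_prod]
    rfl
  have hev : metricInChart (warpedMetric g J w) (q, T) (u, a) (v, b)
      =ᶠ[𝓝 (extChartAt (𝓡 m) q q, (T : ℝ))]
      fun p : EuclideanSpace ℝ (Fin m) × ℝ => w p.2 ^ 2 * metricInChart g q u v p.1 - a * b := by
    have h1 := (isOpen_extChartAt_target (I := 𝓡 m) q).mem_nhds (mem_extChartAt_target q)
    have h2 := (isOpen_extChartAt_target (I := 𝓘(ℝ, ℝ)) T).mem_nhds (mem_extChartAt_target T)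
    filter_upwards [prod_mem_nhds h1 h2] with p hp
    exact metricInChart_warpedMetric g w q T u v a b hp.1 hp.2
  rw [hbase, hev.fderiv_eq]
  have hf := (hg.differentiableAt_metricInChart q u v).hasFDerivAt
  have d1 : HasFDerivAt (fun p : EuclideanSpace ℝ (Fin m) × ℝ => metricInChart g q u v p.1)
      ((fderiv ℝ (metricInChart g q u v) (extChartAt (𝓡 m) q q)).comp
        (ContinuousLinearMap.fst ℝ _ ℝ)) (extChartAt (𝓡 m) q q, (T : ℝ)) :=
    HasFDerivAt.comp (g := metricInChart g q u v) (f := Prod.fst) _ hf hasFDerivAt_fst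
  have d2 : HasFDerivAt (fun p : EuclideanSpace ℝ (Fin m) × ℝ => w p.2)
      (deriv w T • ContinuousLinearMap.snd ℝ (EuclideanSpace ℝ (Fin m)) ℝ)
      (extChartAt (𝓡 m) q q, (T : ℝ)) :=
    HasDerivAt.comp_hasFDerivAt (extChartAt (𝓡 m) q q, (T : ℝ)) hw.hasDerivAt hasFDerivAt_snd
  rw [(((d2.pow 2).fun_mul d1).sub_const (a * b)).fderiv]
  simp
  ring

/-- As `u` and `v` are horizontal, only the term differentiated along `(z, c)` sees the time
derivative of `w²`. -/
theorem christoffelFirst_warpedMetric (hg : IsInducedMetric g ι B) (q : Q) (T : J)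
    (hw : DifferentiableAt ℝ w T) (u v z : EuclideanSpace ℝ (Fin m)) (c : ℝ) :
    christoffelFirst (warpedMetric g J w) (q, T) (u, 0) (v, 0) (z, c) =
      w T ^ 2 * christoffelFirst g q u v z -
        w T * deriv w T * metricInChart g q u v (extChartAt (𝓡 m) q q) * c := by
  rw [christoffelFirst, christoffelFirst, hg.fderiv_metricInChart_warpedMetric q T hw,
    hg.fderiv_metricInChart_warpedMetric q T hw, hg.fderiv_metricInChart_warpedMetric q T hw]
  ring

/-- The factor `w²` cancels horizontally. The time direction is negative, which turns `-w w' g(u,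
v)` into a positive time component. -/
theorem christoffel_warpedMetric (hg : IsInducedMetric g ι B) (p : Q × J)
    (hw : DifferentiableAt ℝ w p.2) (hpos : 0 < w p.2) (u v : TangentSpace (𝓡 m) p.1) :
    christoffel (warpedMetric g J w) p (tangentPair p u 0) (tangentPair p v 0) =
      tangentPair p (christoffel g p.1 u v) (w p.2 * deriv w p.2 * g p.1 u v) := by
  apply christoffel_eq
  · intro a b hab
    obtain ⟨a, s, rfl⟩ := exists_eq_tangentPair p a
    obtain ⟨b, t, rfl⟩ := exists_eq_tangentPair p b
    have h1 : a = b := by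
      refine hg.nondegenerate a b fun z => ?_
      have := hab (tangentPair p z 0)
      rw [warpedMetric_tangentPair, warpedMetric_tangentPair] at this
      simpa [hpos.ne'] using this
    have h2 : s = t := by
      have := hab (tangentPair p 0 1)
      rw [warpedMetric_tangentPair, warpedMetric_tangentPair] at this
      simpa using this
    rw [h1, h2]
  · intro z
    obtain ⟨z, c, rfl⟩ := exists_eq_tangentPair p z
    rw [warpedMetric_tangentPair, hg.metric_christoffel]
    refine Eq.trans ?_ (hg.christoffelFirst_warpedMetric p.1 p.2 hw u v z c).symm
    exact congrArg (fun x => _ - w p.2 * deriv w p.2 * x * c) (hg.metricInChart_self p.1 u v).symm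

variable {n : ℕ} {M : Type*} [TopologicalSpace M] [ChartedSpace (EuclideanSpace ℝ (Fin n)) M]
  {φ : M → Q} {T : J}

theorem covariantHessian_slice (hg : IsInducedMetric g ι B) (hφ : ContMDiff (𝓡 n) (𝓡 m) 2 φ)
    (hw : DifferentiableAt ℝ w T) (hpos : 0 < w T) (x : M) (u v : TangentSpace (𝓡 n) x) :
    covariantHessian (warpedMetric g J w) (fun x => (φ x, T)) x u v =
      tangentPair (φ x, T) (covariantHessian g φ x u v) (w T * deriv w T *
        g (φ x) (mfderiv (𝓡 n) (𝓡 m) φ x u) (mfderiv (𝓡 n) (𝓡 m) φ x v)) := by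
  have hφd := hφ.mdifferentiable (n := 2) (by simp)
  have hφx := hφ.contMDiffAt (x := x)
  set h := writtenInExtChartAt (𝓡 n) (𝓡 m) x φ with hh
  have hsm : ContDiffAt ℝ 2 h (extChartAt (𝓡 n) x x) := by
    have := (contMDiffAt_iff.1 hφx).2
    rwa [modelWithCornersSelf_coe, Set.range_id, contDiffWithinAt_univ] at this
  have hw' : writtenInExtChartAt (𝓡 n) ((𝓡 m).prod 𝓘(ℝ, ℝ)) x (fun x => (φ x, T)) =
      fun y => (h y, (T : ℝ)) := by
    funext y
    simp only [writtenInExtChartAt, extChartAt_prod]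
    rfl
  have hD : fderiv ℝ (fun y => (h y, (T : ℝ))) =ᶠ[𝓝 (extChartAt (𝓡 n) x x)]
      fun y => (ContinuousLinearMap.inl ℝ _ ℝ).comp (fderiv ℝ h y) := by
    filter_upwards [hsm.eventually (by simp)] with y hy
    have d := (hy.differentiableAt (by simp)).hasFDerivAt
    rw [(d.prodMk (hasFDerivAt_const (T : ℝ) y)).fderiv]
    ext1 a
    simp
  have hDD : ∀ u v : EuclideanSpace ℝ (Fin n), fderiv ℝ (fderiv ℝ (fun y => (h y, (T : ℝ))))
      (extChartAt (𝓡 n) x x) u v = (fderiv ℝ (fderiv ℝ h) (extChartAt (𝓡 n) x x) u v, 0) := by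
    intro u v
    have d1 : DifferentiableAt ℝ (fderiv ℝ h) (extChartAt (𝓡 n) x x) :=
      (hsm.fderiv_right (m := 1) (by norm_num)).differentiableAt (by simp)
    rw [hD.fderiv_eq, ((hasFDerivAt_const (ContinuousLinearMap.inl ℝ (EuclideanSpace ℝ (Fin m)) ℝ)
      _).clm_comp d1.hasFDerivAt).fderiv]
    simp
  rw [covariantHessian, mfderiv_slice hφd, mfderiv_slice hφd,
    hg.christoffel_warpedMetric (φ x, T) hw hpos, covariantHessian]
  rw [hw']
  refine (congrArg (fun a : TangentSpace ((𝓡 m).prod 𝓘(ℝ, ℝ)) (φ x, T) => a + _) (hDD u v)).trans ?_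
  refine (tangentPair_add (φ x, T) _ _ _ _).trans ?_
  rw [zero_add]

end IsInducedMetric

namespace IsInducedMetric

section Slice

variable {m : ℕ} {Q : Type*} [TopologicalSpace Q] [ChartedSpace (EuclideanSpace ℝ (Fin m)) Q]
  {V : Type*} [NormedAddCommGroup V] [NormedSpace ℝ V]
  {g : TensorField (𝓡 m) Q} {ι : Q → V} {B : V →L[ℝ] V →L[ℝ] ℝ}
  {J : TopologicalSpace.Opens ℝ} {w : ℝ → ℝ}
  {n : ℕ} {M : Type*} [TopologicalSpace M] [ChartedSpace (EuclideanSpace ℝ (Fin n)) M]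
  {φ : M → Q} {T : J}

theorem metric_slice (hφ : MDifferentiable (𝓡 n) (𝓡 m) φ) (x : M) (u v : TangentSpace (𝓡 n) x) :
    warpedMetric g J w (φ x, T)
        (mfderiv (𝓡 n) ((𝓡 m).prod 𝓘(ℝ, ℝ)) (fun x => (φ x, T)) x u)
        (mfderiv (𝓡 n) ((𝓡 m).prod 𝓘(ℝ, ℝ)) (fun x => (φ x, T)) x v) =
      w T ^ 2 * g (φ x) (mfderiv (𝓡 n) (𝓡 m) φ x u) (mfderiv (𝓡 n) (𝓡 m) φ x v) := by
  rw [mfderiv_slice hφ, mfderiv_slice hφ, warpedMetric_tangentPair]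
  simp

theorem gramMatrix_slice (hφ : MDifferentiable (𝓡 n) (𝓡 m) φ) (x : M) :
    gramMatrix (warpedMetric g J w) (fun x => (φ x, T)) x = w T ^ 2 • gramMatrix (n := n) g φ x := by
  ext i j
  exact metric_slice hφ x _ _

/-- The time direction is normal to the slice, so only the horizontal part is projected. -/
theorem normalPart_slice (hg : IsInducedMetric g ι B) (hφ : IsImmersionOfClass (𝓡 m) n 2 φ)
    (hpos : 0 < w T) (x : M) (ξ : TangentSpace (𝓡 m) (φ x)) (s : ℝ) :
    normalPart (n := n) (warpedMetric g J w) (fun x => (φ x, T)) x (tangentPair (φ x, T) ξ s) =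
      tangentPair (φ x, T) (normalPart (n := n) g φ x ξ) s := by
  have hφd := hφ.1.mdifferentiable (by simp)
  have ha := hg.isAnisotropicAt hφ x
  obtain ⟨η, hη, u, hu⟩ := exists_normal_decomposition ha ξ
  rw [normalPart_eq ha hη hu]
  refine normalPart_eq (u := u) (fun v hv => ha v ?_) (fun v => ?_) ?_
  · rw [metric_slice hφd] at hv
    simpa [hpos.ne'] using hv
  · rw [mfderiv_slice hφd, warpedMetric_tangentPair, hη v]
    simp
  · rw [mfderiv_slice hφd, tangentPair_add, zero_add, hu]

variable [IsManifold (𝓡 m) ∞ Q]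

/-- The inverse Gram matrix scales by `w⁻²`. In the time component, the trace of the induced metric
against itself is `n`. -/
theorem meanCurvatureVector_slice (hn : 1 ≤ n) (hg : IsInducedMetric g ι B)
    (hφ : IsImmersionOfClass (𝓡 m) n 2 φ) (hw : DifferentiableAt ℝ w T) (hpos : 0 < w T) (x : M) :
    meanCurvatureVector (n := n) (warpedMetric g J w) (fun x => (φ x, T)) x =
      tangentPair (φ x, T) ((w T ^ 2)⁻¹ • meanCurvatureVector (n := n) g φ x)
        (deriv w T / w T) := by
  have hφd := hφ.1.mdifferentiable (n := 2) (by simp)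
  have hw0 : w T ≠ 0 := hpos.ne'
  have hdet : (gramMatrix (n := n) g φ x).det ≠ 0 := by
    rw [hg.gramMatrix_eq hφ.1]
    refine det_flatGram_ne_zero B fun u hu => ?_
    rw [fderiv_coordRep_self ((hg.contMDiff_comp hφ.1).mdifferentiable (by simp) x)] at hu
    exact hg.isAnisotropicAt hφ x u ((hg.metric_mfderiv hφ.1 x u u).trans hu)
  have hinv : (w T ^ 2 • gramMatrix (n := n) g φ x)⁻¹ = (w T ^ 2)⁻¹ • (gramMatrix g φ x)⁻¹ :=
    Matrix.inv_smul' _ (Units.mk0 (w T ^ 2) (pow_ne_zero 2 hw0)) (isUnit_iff_ne_zero.2 hdet)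
  have htrace : ∑ i : Fin n, ∑ j : Fin n, (gramMatrix g φ x)⁻¹ i j * gramMatrix g φ x i j = n := by
    have hs : ∀ i j : Fin n, gramMatrix g φ x i j = gramMatrix g φ x j i := fun i j => hg.symm _ _ _
    calc _ = ((gramMatrix (n := n) g φ x)⁻¹ * gramMatrix g φ x).trace := by
          simp only [Matrix.trace, Matrix.diag_apply, Matrix.mul_apply]
          exact Finset.sum_congr rfl fun i _ => Finset.sum_congr rfl fun j _ => by rw [hs i j]
      _ = (n : ℝ) := by
          rw [Matrix.nonsing_inv_mul _ (isUnit_iff_ne_zero.2 hdet), Matrix.trace_one,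
            Fintype.card_fin]
  rw [meanCurvatureVector, gramMatrix_slice hφd, hinv]
  simp only [secondFundamentalForm, hg.covariantHessian_slice hφ.1 hw hpos,
    hg.normalPart_slice hφ hpos, smul_tangentPair, sum_tangentPair, Matrix.smul_apply,
    smul_eq_mul]
  refine congrArg₂ (tangentPair (φ x, T)) ?_ ?_
  · rw [meanCurvatureVector, smul_comm]
    simp only [mul_smul, Finset.smul_sum]
    rfl
  · have h : ∀ i j : Fin n, (w T ^ 2)⁻¹ * (gramMatrix g φ x)⁻¹ i j * (w T * deriv w T *
        g (φ x) (mfderiv (𝓡 n) (𝓡 m) φ x (coordVec x i)) (mfderiv (𝓡 n) (𝓡 m) φ x (coordVec x j))) =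
        deriv w T / w T * ((gramMatrix g φ x)⁻¹ i j * gramMatrix g φ x i j) := by
      intro i j
      have : gramMatrix g φ x i j = g (φ x) (mfderiv (𝓡 n) (𝓡 m) φ x (coordVec x i))
        (mfderiv (𝓡 n) (𝓡 m) φ x (coordVec x j)) := rfl
      rw [this]
      field_simp
    simp only [h, ← Finset.mul_sum, htrace]
    -- Here `n ≥ 1` matters: the `n` of the trace must cancel the `1 / n`.
    have : (n : ℝ) ≠ 0 := by positivity
    field_simp

theorem isMarginallyTrapped_slice_iff (hn : 1 ≤ n) (hg : IsInducedMetric g ι B)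
    (hφ : IsImmersionOfClass (𝓡 m) n 2 φ) (hw : DifferentiableAt ℝ w T) (hpos : 0 < w T) :
    IsMarginallyTrapped (warpedMetric g J w) n (fun x : M => (φ x, T)) ↔
      ∀ x, g (φ x) (meanCurvatureVector (n := n) g φ x) (meanCurvatureVector (n := n) g φ x) =
        deriv w T ^ 2 := by
  have hw0 : w T ≠ 0 := hpos.ne'
  refine forall_congr' fun x => ?_
  rw [hg.meanCurvatureVector_slice hn hφ hw hpos, warpedMetric_tangentPair]
  simp only [map_smul, LinearMap.smul_apply, smul_eq_mul]
  rw [sub_eq_zero]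
  field_simp

end Slice

/-! ### Constant mean curvature as a condition on the length of `H`. -/

section Hypersurface

variable {n : ℕ} {Q : Type*} [TopologicalSpace Q]
  [ChartedSpace (EuclideanSpace ℝ (Fin (n + 1))) Q] [IsManifold (𝓡 (n + 1)) ∞ Q]
  {V : Type*} [NormedAddCommGroup V] [NormedSpace ℝ V]
  {g : TensorField (𝓡 (n + 1)) Q} {ι : Q → V} {B : V →L[ℝ] V →L[ℝ] ℝ}
  {M : Type*} [TopologicalSpace M] [ChartedSpace (EuclideanSpace ℝ (Fin n)) M]
  {φ : M → Q} {k : ℝ}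

theorem metric_meanCurvatureVector_self_of_hasConstantMeanCurvature (hg : IsInducedMetric g ι B)
    (hφ : IsImmersionOfClass (𝓡 (n + 1)) n 2 φ) (h : HasConstantMeanCurvature g n φ k) (x : M) :
    g (φ x) (meanCurvatureVector (n := n) g φ x) (meanCurvatureVector (n := n) g φ x) = k ^ 2 := by
  obtain ⟨U, -, hx, ν, hν, hk⟩ := h x
  rw [hg.metric_meanCurvatureVector_self hφ (hν.2 x hx).1 (hν.2 x hx).2]
  exact congrArg (· ^ 2) (hk x hx)

theorem hasConstantMeanCurvature_iff [IsManifold (𝓡 n) 2 M] (hg : IsInducedMetric g ι B)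
    (hφ : IsImmersionOfClass (𝓡 (n + 1)) n 2 φ) :
    HasConstantMeanCurvature g n φ k ↔
      ∀ x, g (φ x) (meanCurvatureVector (n := n) g φ x) (meanCurvatureVector (n := n) g φ x) =
        k ^ 2 := by
  refine ⟨hg.metric_meanCurvatureVector_self_of_hasConstantMeanCurvature hφ, fun h x => ?_⟩
  obtain ⟨U, hU, hx, ν₀, hν₀⟩ := hg.exists_local_unitNormalField hφ x
  exact ⟨U, hU, hx,
    hg.exists_unitNormalField_meanCurvature_eq hφ hU hν₀ fun y _ => h y⟩

theorem hasConstantMeanCurvatureGlobally_iff [IsManifold (𝓡 n) 2 M] (hg : IsInducedMetric g ι B)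
    (hφ : IsImmersionOfClass (𝓡 (n + 1)) n 2 φ)
    {ν₀ : (x : M) → TangentSpace (𝓡 (n + 1)) (φ x)}
    (hν₀ : IsUnitNormalFieldOn g n φ Set.univ ν₀) :
    HasConstantMeanCurvatureGlobally g n φ k ↔
      ∀ x, g (φ x) (meanCurvatureVector (n := n) g φ x) (meanCurvatureVector (n := n) g φ x) =
        k ^ 2 := by
  constructor
  · rintro ⟨ν, hν, hk⟩
    exact hg.metric_meanCurvatureVector_self_of_hasConstantMeanCurvature hφ fun x =>
      ⟨Set.univ, isOpen_univ, Set.mem_univ x, ν, hν, fun y _ => hk y⟩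
  · intro h
    obtain ⟨ν, hν, hk⟩ := hg.exists_unitNormalField_meanCurvature_eq hφ isOpen_univ hν₀
      fun y _ => h y
    exact ⟨ν, hν, fun x => hk x (Set.mem_univ x)⟩

end Hypersurface

end IsInducedMetric
end RobertsonWalker

end

theorem corollary3 (n : ℕ) (hn : 1 ≤ n) (c : SignType)
    (J : TopologicalSpace.Opens ℝ) (hJ : (J : Set ℝ).OrdConnected)
    (w : ℝ → ℝ) (hw : ContDiffOn ℝ ∞ w J) (hwpos : ∀ t ∈ J, 0 < w t)
    {M : Type*} [TopologicalSpace M] [ChartedSpace (EuclideanSpace ℝ (Fin n)) M]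
    [IsManifold (𝓡 n) 2 M]
    (φ : M → RobertsonWalker.SpaceForm (n + 1) c)
    (hφ : RobertsonWalker.IsImmersionOfClass (𝓡 (n + 1)) n 2 φ) (T : J) :
    (RobertsonWalker.IsMarginallyTrapped (RobertsonWalker.metric (n + 1) c J w) n
        (fun x : M => (φ x, T)) ↔
      RobertsonWalker.HasConstantMeanCurvature (RobertsonWalker.SpaceForm.metric (n + 1) c) n φ
        (deriv w T)) ∧
    ((∃ ν₀ : (x : M) → TangentSpace (𝓡 (n + 1)) (φ x),
        RobertsonWalker.IsUnitNormalFieldOn (RobertsonWalker.SpaceForm.metric (n + 1) c) n φ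
          Set.univ ν₀) →
      (RobertsonWalker.IsMarginallyTrapped (RobertsonWalker.metric (n + 1) c J w) n
          (fun x : M => (φ x, T)) ↔
        RobertsonWalker.HasConstantMeanCurvatureGlobally
          (RobertsonWalker.SpaceForm.metric (n + 1) c) n φ (deriv w T))) := by
  obtain ⟨N, ι, B, hg⟩ := RobertsonWalker.SpaceForm.exists_isInducedMetric (n + 1) c
  have hwT : DifferentiableAt ℝ w T :=
    (hw.differentiableOn (by simp)).differentiableAt (J.isOpen.mem_nhds T.2)
  have htrapped := hg.isMarginallyTrapped_slice_iff hn hφ hwT (hwpos T T.2)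
  refine ⟨htrapped.trans (hg.hasConstantMeanCurvature_iff hφ).symm, ?_⟩
  rintro ⟨ν₀, hν₀⟩
  exact htrapped.trans (hg.hasConstantMeanCurvatureGlobally_iff hφ hν₀).symm
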